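/- **Setting.** Consider a finite two-player zero-sum extensive-form game with chance and perfect recall, whose payoffs satisfy $|v_i(z)|\le\Delta$ at every terminal history $z$. A joint behavioural strategy $\pi$ is an $\epsilon$-Nash equilibrium if $\min_{\pi'_{-i}}v_i(\pi_i,\pi'_{-i})+\epsilon\ge v_i(\pi)\ge\max_{\pi'_i}v_i(\pi'_i,\pi_{-i})-\epsilon$ for both players $i$. A *population* assigns to every information set a nonempty set of available actions; in the *restricted game* of a population the players may only use these actions. For the restricted game of the $j$-th time window let $S_{i,j}$ be the set of player $i$'s information sets that can be reached in it, $|A_j|$ the largest number of actions available at one of them, and $H_j=\max_i H_{i,j}$, where $H_{i,j}$ is the largest number of decisions of player $i$ along a trajectory of it. $|A|$ and $H$ are the corresponding numbers for the full game. **Algorithm (SADO, for accuracy $\epsilon$).** The initial population consists of the actions of pure best responses of the two players, in the full game, to the uniform strategy, and opens the first window. Iterations are numbered $t=1,2,\dots$. In iteration $t$, belonging to window $j$: 1. One iteration of outcome-sampling MCCFR is run in the current restricted game: the current strategy $\pi^t$ is given by regret matching on the sampled counterfactual regrets accumulated in the current window (so it is uniform at the start of a window); one terminal history $z$ is sampled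 with a sampling strategy of the restricted game (chance following its own distribution), and the importance-weighted sampled counterfactual regrets of both players are accumulated. The sampling strategy may depend on the population and on $\pi^t$; the players' contribution to its probability of reaching $z$ is at least $\delta>0$ for every terminal history $z$ of the restricted game ($\delta$ is the exploration parameter). 2. The *last-window average strategy* $\tilde\pi^t$ is the average of the strategies $\pi^s$ of the current window, $s\le t$, each weighted at an information set by its owner's contribution to the probability of reaching it; if all these weights vanish it is uniform on the available actions. Actions outside the population have probability $0$. 3. If $t$ is a multiple of $$m(j)=\left\lceil\sqrt{\frac{|A_j|\,(\sum_i|S_{i,j}|)^3}{H_j\,\epsilon^2}}\,\right\rceil ,$$ an oracle returns for each player a pure best response, in the full game, to $\tilde\pi^t$ (ties broken arbitrarily), and its actions are merged into the population. If the population changes, a new window with the new restricted game starts and regrets and averages are reset. **Sample complexity.** An MCCFR iteration uses as many samples as the sampled trajectory visits decision nodes of the players (at most $2H_j$); a best-response computation in window $j$ is charged $\sum_i|S_{i,j}|$ samples, and the initial best-response computation is charged the size of the first restricted game. The sample complexity is the number of samples used up to and including the first iteration $\tau$ at which $\tilde\pi^\tau$ is an $\epsilon$-Nash equilibrium of the full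 game. Let $k$ be the number of windows up to iteration $\tau$ and $X=\sum_i|S_{i,k}|$ the size of the restricted game in which iteration $\tau$ takes place. **Theorem (SADO).** For all $\Delta>0$ and $\delta>0$ there are constants $C>0$ and $d\in\mathbb N$, depending only on $\Delta$ and $\delta$, such that for every such game, every best-response oracle, every sampling scheme with exploration parameter $\delta$, all $0<\epsilon\le 2\Delta$ and all $0<p\le1$, with probability at least $1-p$ the iteration $\tau$ exists and the sample complexity is at most $$C\left(\frac{k|A|HX^2}{\epsilon^2}+\frac{2k\sqrt{|A|H}\,X^{1.5}}{\epsilon}\right)\left(\log\Big(2+\frac{k|A|HX}{\epsilon p}\Big)\right)^{d}.$$ That is, it is $\tilde{\mathcal O}\big(k|A|HX^2/\epsilon^2+2k\sqrt{|A|H}X^{1.5}/\epsilon\big)$. -/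

import Mathlib

noncomputable section

open scoped Classical

/-- A finite two-player zero-sum extensive-form game with chance. A history is the list of the
actions taken so far, most recent action first, so `a :: h` is the history `h · a`. The value
`info h = some s` means that the nonterminal history `h` lies in the information set `s`, at which
player `owner s` moves; `info h = none` means that chance moves at `h`. -/
structure EFG (Act Info : Type*) [Fintype Act] where
  hist : Finset (List Act)
  nil_mem : [] ∈ hist
  tail_mem : ∀ a h, a :: h ∈ hist → h ∈ hist
  info : List Act → Option Info
  owner : Info → Fin 2
  /-- the available actions `A(s)` -/
  acts : Info → Finset Act
  mem_acts : ∀ h ∈ hist, (∃ b, b :: h ∈ hist) → ∀ s, info h = some s →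
    ∀ a, a ∈ acts s ↔ a :: h ∈ hist
  exists_node : ∀ s, ∃ h ∈ hist, (∃ b, b :: h ∈ hist) ∧ info h = some s
  /-- `chance h a` is the probability that chance plays `a` at `h` -/
  chance : List Act → Act → ℝ
  chance_nonneg : ∀ h a, 0 ≤ chance h a
  chance_support : ∀ h a, a :: h ∉ hist → chance h a = 0
  chance_sum : ∀ h ∈ hist, (∃ b, b :: h ∈ hist) → info h = none → ∑ a, chance h a = 1
  /-- payoff of player `0` at terminal histories; player `1` receives the opposite -/
  payoff : List Act → ℝ

namespace EFG

variable {Act Info : Type*} [Fintype Act] [Fintype Info] (G : EFG Act Info)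

/-! ### Histories, information sets, perfect recall -/

/-- The terminal histories `Z`. -/
def terminals : Finset (List Act) := G.hist.filter fun h => ∀ a, a :: h ∉ G.hist

/-- The histories that make up the information set `s`. -/
def nodes (s : Info) : Finset (List Act) :=
  G.hist.filter fun h => (∃ b, b :: h ∈ G.hist) ∧ G.info h = some s

/-- The sequence of own information sets and own actions of player `i` along a history
(most recent first). -/
def experience (i : Fin 2) : List Act → List (Info × Act)
  | [] => []
  | a :: h =>
    match G.info h with
    | some s => if G.owner s = i then (s, a) :: experience i h else experience i h
    | none => experience i h

/-- Perfect recall: histories in one information set carry the same experience of its owner. -/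
def PerfectRecall : Prop :=
  ∀ s, ∀ h ∈ G.nodes s, ∀ h' ∈ G.nodes s,
    G.experience (G.owner s) h = G.experience (G.owner s) h'

/-- The payoff `v_i(z)`. -/
def util (i : Fin 2) (z : List Act) : ℝ := if i = 0 then G.payoff z else -G.payoff z

/-! ### Strategies, reaching probabilities, values, equilibria -/

/-- `σ` is a joint behavioural strategy of the two players (every information set belongs to
exactly one of them) that only uses the actions in `P`. -/
def IsStrategyOn (P : Info → Finset Act) (σ : Info → Act → ℝ) : Prop :=
  ∀ s, (∀ a, 0 ≤ σ s a) ∧ (∀ a, a ∉ P s → σ s a = 0) ∧ ∑ a, σ s a = 1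

/-- `σ` is a joint behavioural strategy of the game. -/
def IsStrategy (σ : Info → Act → ℝ) : Prop := IsStrategyOn G.acts σ

/-- The product of the factors `f g a` over the steps from `g` to `g · a` on the path from `h`
down to a history `z`; it is `0` if `h` is not a prefix of `z`. -/
def pathProd (f : List Act → Act → ℝ) (h : List Act) : List Act → ℝ
  | [] => if h = [] then 1 else 0
  | a :: z => if h = a :: z then 1 else f z a * pathProd f h z

/-- The probability that `a` is played at `h`. -/
def stepProb (σ : Info → Act → ℝ) (h : List Act) (a : Act) : ℝ :=
  match G.info h with
  | some s => σ s a
  | none => G.chance h a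

/-- The probability of getting from `h` to `z`. -/
def reachFrom (σ : Info → Act → ℝ) (h z : List Act) : ℝ := pathProd (G.stepProb σ) h z

/-- The reaching probability `x^σ(z)`. -/
def reach (σ : Info → Act → ℝ) (z : List Act) : ℝ := G.reachFrom σ [] z

/-- The contribution `x_i^σ(z)` of player `i` to the reaching probability. -/
def ownReach (σ : Info → Act → ℝ) (i : Fin 2) (z : List Act) : ℝ :=
  pathProd (fun h a => match G.info h with
    | some s => if G.owner s = i then σ s a else 1
    | none => 1) [] z

/-- The contribution `x_{-i}^σ(z)` of the opponent of player `i` and of chance. -/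
def cfReach (σ : Info → Act → ℝ) (i : Fin 2) (z : List Act) : ℝ :=
  pathProd (fun h a => match G.info h with
    | some s => if G.owner s = i then 1 else σ s a
    | none => G.chance h a) [] z

/-- The value `v_i(σ)`. -/
def value (σ : Info → Act → ℝ) (i : Fin 2) : ℝ :=
  ∑ z ∈ G.terminals, G.reach σ z * G.util i z

/-- The joint strategy `(τ_i, σ_{-i})`. -/
def deviate (i : Fin 2) (τ σ : Info → Act → ℝ) : Info → Act → ℝ :=
  fun s => if G.owner s = i then τ s else σ s

/-- `σ` is an `ε`-Nash equilibrium. -/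
def IsNash (ε : ℝ) (σ : Info → Act → ℝ) : Prop :=
  G.IsStrategy σ ∧ ∀ i : Fin 2, ∀ τ, G.IsStrategy τ →
    G.value σ i ≤ G.value (G.deviate i σ τ) i + ε ∧
    G.value (G.deviate i τ σ) i - ε ≤ G.value σ i

/-- The uniform strategy over the actions in `P`. -/
def uniform (P : Info → Finset Act) : Info → Act → ℝ :=
  fun s a => if a ∈ P s then 1 / ((P s).card : ℝ) else 0

/-- The behavioural strategy that plays the pure strategy `b`. -/
def pureStrategy (b : Info → Act) : Info → Act → ℝ := fun s a => if a = b s then 1 else 0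

/-- An oracle that returns, for each player `i` and each joint strategy `σ`, a pure best response
of player `i` to `σ_{-i}` in the full game, ties being broken in any way. (The values of `br i σ`
at information sets of the other player play no role.) -/
def IsBestResponseOracle (br : Fin 2 → (Info → Act → ℝ) → Info → Act) : Prop :=
  ∀ i σ, G.IsStrategy σ → (∀ s, br i σ s ∈ G.acts s) ∧
    ∀ τ, G.IsStrategy τ →
      G.value (G.deviate i τ σ) i ≤ G.value (G.deviate i (pureStrategy (br i σ)) σ) i

/-! ### Restricted games

A population is given by the set `P s` of the actions that it makes available at each information
set `s`. In the restricted game the players may only use these actions. -/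

/-- The history is possible in the restricted game. -/
def Allowed (P : Info → Finset Act) : List Act → Prop
  | [] => True
  | a :: h => Allowed P h ∧ ∀ s, G.info h = some s → a ∈ P s

/-- The information sets `S_{i,j}` of player `i` in the restricted game. -/
def restrInfosets (P : Info → Finset Act) (i : Fin 2) : Finset Info :=
  Finset.univ.filter fun s => G.owner s = i ∧ ∃ h ∈ G.nodes s, G.Allowed P h

/-- The size `∑ i, |S_{i,j}|` of the restricted game. -/
def restrSize (P : Info → Finset Act) : ℕ := ∑ i, (G.restrInfosets P i).card

/-- `|A_j|`, the largest number of actions at an information set of the restricted game. -/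
def restrActs (P : Info → Finset Act) : ℕ :=
  Finset.univ.sup fun i : Fin 2 => (G.restrInfosets P i).sup fun s => (P s).card

/-- `H_j = max_i H_{i,j}`, where `H_{i,j}` is the largest number of decisions of player `i` along
a trajectory of the restricted game. -/
def restrHorizon (P : Info → Finset Act) : ℕ :=
  Finset.univ.sup fun i : Fin 2 =>
    (G.hist.filter fun h => G.Allowed P h).sup fun h => (G.experience i h).length

/-- `|A|` -/
def maxActs : ℕ := G.restrActs G.acts

/-- `H` -/
def horizon : ℕ := G.restrHorizon G.acts

/-! ### Outcome-sampling MCCFR in a restricted game -/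

/-- Regret matching on the actions in `P` with cumulative regrets `R`. -/
def regretMatching (P : Info → Finset Act) (R : Info → Act → ℝ) : Info → Act → ℝ :=
  fun s a =>
    if 0 < ∑ b ∈ P s, max (R s b) 0 then
      if a ∈ P s then max (R s a) 0 / ∑ b ∈ P s, max (R s b) 0 else 0
    else uniform P s a

/-- The sampled counterfactual regret of the action `a` at `s` when the terminal history `z` was
drawn with the sampling strategy `ξ` while the current strategy was `σ`. At most one summand is
nonzero, that of the history in `s` through which `z` passes. -/
def sampledRegret (ξ σ : Info → Act → ℝ) (z : List Act) : Info → Act → ℝ :=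
  fun s a => ∑ h ∈ G.nodes s,
    G.cfReach σ (G.owner s) h * (G.reachFrom σ (a :: h) z - G.reachFrom σ h z)
      * G.util (G.owner s) z / G.reach ξ z

/-- A sampling scheme with exploration parameter `δ` assigns to a population and a current strategy
in the restricted game the strategy with which the trajectory is sampled; under it, the two players
together contribute at least `δ` to the probability of every terminal history of the restricted
game. -/
def IsSamplingScheme (δ : ℝ)
    (ξ : (Info → Finset Act) → (Info → Act → ℝ) → Info → Act → ℝ) : Prop :=
  ∀ P : Info → Finset Act, (∀ s, (P s).Nonempty ∧ P s ⊆ G.acts s) →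
    ∀ σ, IsStrategyOn P σ → IsStrategyOn P (ξ P σ) ∧
      ∀ z ∈ G.terminals, G.Allowed P z → δ ≤ ∏ i, G.ownReach (ξ P σ) i z

/-- The number of decision nodes of the players that a sampled trajectory visits. -/
def visited (z : List Act) : ℕ := ∑ i, (G.experience i z).length

/-! ### Stochastic regret-minimizing double oracle with the adaptive frequency function -/

/-- The state between two iterations. -/
structure SADOState (Act Info : Type*) where
  /-- the population -/
  pop : Info → Finset Act
  /-- the index of the current time window, starting from `0` -/
  window : ℕ
  /-- the sampled regrets accumulated in the current window -/
  regret : Info → Act → ℝ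
  /-- the reach-weighted strategies accumulated in the current window -/
  weight : Info → Act → ℝ
  /-- the samples used so far -/
  cost : ℕ

/-- The adaptive frequency function `m(j)`, rounded up. -/
def frequency (ε : ℝ) (P : Info → Finset Act) : ℕ :=
  ⌈Real.sqrt ((G.restrActs P : ℝ) * (G.restrSize P : ℝ) ^ 3
      / ((G.restrHorizon P : ℝ) * ε ^ 2))⌉₊

/-- The strategy `π^t` that the next iteration plays. -/
def current (st : SADOState Act Info) : Info → Act → ℝ := regretMatching st.pop st.regret

/-- The accumulated reach-weighted strategies, next iteration included. By perfect recall all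
histories in `s` have the same `ownReach` for the owner of `s`, so the sum over them is that number
times a factor that cancels in `lastWindowAverage`. -/
def newWeight (st : SADOState Act Info) : Info → Act → ℝ :=
  fun s a => st.weight s a +
    (∑ h ∈ G.nodes s, G.ownReach (current st) (G.owner s) h) * current st s a

/-- The last-window average strategy of the next iteration: the average of the strategies of the
current window, that iteration included, each weighted by its own player's reaching probability. It
gives probability `0` to the actions outside the population. -/
def lastWindowAverage (st : SADOState Act Info) : Info → Act → ℝ :=
  fun s a =>
    if 0 < ∑ b, G.newWeight st s b then G.newWeight st s a / ∑ b, G.newWeight st s b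
    else uniform st.pop s a

/-- The population merged with the best responses of both players to `σ`. -/
def expand (br : Fin 2 → (Info → Act → ℝ) → Info → Act) (σ : Info → Act → ℝ)
    (P : Info → Finset Act) : Info → Finset Act :=
  fun s => insert (br (G.owner s) σ s) (P s)

/-- The start: the population consists of the best responses to the uniform strategy. -/
def initial (br : Fin 2 → (Info → Act → ℝ) → Info → Act) : SADOState Act Info where
  pop := fun s => {br (G.owner s) (uniform G.acts) s}
  window := 0
  regret := 0
  weight := 0
  cost := G.restrSize fun s => {br (G.owner s) (uniform G.acts) s}

/-- Iteration number `t`, in which the trajectory `z` is sampled. The iteration of MCCFR uses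
`visited z` samples; computing best responses uses as many samples as the current restricted game
has information sets. -/
def step (ε : ℝ) (br : Fin 2 → (Info → Act → ℝ) → Info → Act)
    (ξ : (Info → Finset Act) → (Info → Act → ℝ) → Info → Act → ℝ)
    (t : ℕ) (st : SADOState Act Info) (z : List Act) : SADOState Act Info :=
  let R : Info → Act → ℝ :=
    st.regret + G.sampledRegret (ξ st.pop (current st)) (current st) z
  let P : Info → Finset Act := G.expand br (G.lastWindowAverage st) st.pop
  if t % G.frequency ε st.pop = 0 then
    if P = st.pop then
      ⟨st.pop, st.window, R, G.newWeight st, st.cost + G.visited z + G.restrSize st.pop⟩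
    else
      ⟨P, st.window + 1, 0, 0, st.cost + G.visited z + G.restrSize st.pop⟩
  else ⟨st.pop, st.window, R, G.newWeight st, st.cost + G.visited z⟩

/-- The state after `t` iterations when `w 1, w 2, …` are the sampled trajectories. -/
def run (ε : ℝ) (br : Fin 2 → (Info → Act → ℝ) → Info → Act)
    (ξ : (Info → Finset Act) → (Info → Act → ℝ) → Info → Act → ℝ)
    (w : ℕ → List Act) : ℕ → SADOState Act Info
  | 0 => G.initial br
  | t + 1 => G.step ε br ξ (t + 1) (run ε br ξ w t) (w (t + 1))

/-- The random trajectories `ζ 1, ζ 2, …` are those of an execution of the algorithm: given the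
first `t` of them, the next one is drawn with the sampling strategy of the state that they lead
to. -/
structure IsExecution (ε : ℝ) (br : Fin 2 → (Info → Act → ℝ) → Info → Act)
    (ξ : (Info → Finset Act) → (Info → Act → ℝ) → Info → Act → ℝ)
    {Ω : Type*} [MeasurableSpace Ω] (μ : MeasureTheory.Measure Ω)
    (ζ : ℕ → Ω → List Act) : Prop where
  measurable : ∀ t w, MeasurableSet {ω | ζ t ω = w}
  law : ∀ (t : ℕ) (w : ℕ → List Act), w (t + 1) ∈ G.terminals →
    μ {ω | ∀ s ∈ Finset.Icc 1 (t + 1), ζ s ω = w s} =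
      μ {ω | ∀ s ∈ Finset.Icc 1 t, ζ s ω = w s} *
        ENNReal.ofReal (G.reach
          (ξ (run G ε br ξ w t).pop (current (run G ε br ξ w t))) (w (t + 1)))

/-- `k|A|HX²/ε² + 2k√(|A|H) X^{1.5}/ε` -/
def sadoBound (ε : ℝ) (k X : ℕ) : ℝ :=
  (k : ℝ) * G.maxActs * G.horizon * (X : ℝ) ^ 2 / ε ^ 2
    + 2 * k * Real.sqrt ((G.maxActs : ℝ) * G.horizon) * (X : ℝ) ^ (1.5 : ℝ) / ε

/-- The logarithm of the parameters. -/
def logFactor (ε p : ℝ) (k X : ℕ) : ℝ :=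
  Real.log (2 + (k : ℝ) * G.maxActs * G.horizon * X / (ε * p))

end EFG

end

/-!
The theorem combines a regret bound for outcome-sampling MCCFR within a time window with an
accounting of windows and oracle calls.

*Equilibria from regrets.* By the performance difference identity (`value_deviate_sub_value`) and
perfect recall, the regret of a player in the restricted game is at most the sum of the cumulative
counterfactual regrets at the information sets of that game (`sum_value_deviate_sub_le`). The
last-window average is realization equivalent to the uniform mixture of the strategies of the window
(`card_mul_ownReach_averageStrategy`). If an oracle call does not enlarge the population, the best
responses in the full game belong to the restricted game, so a small regret makes the average an
equilibrium of the full game (`isNash_averageStrategy`).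

*Regret matching.* Because the sampling strategy explores every terminal history of the restricted
game, the sampled counterfactual regrets are unbiased and bounded by `Δ / δ`
(`cfReach_mul_reachFrom_le`, `abs_sampledRegret_le`, `sum_reach_mul_sampledRegret`). After `n`
iterations of a window, regret matching keeps the sampled regrets below `(Δ / δ) √(n |A_j|)`
(`regret_le`).

*Concentration.* The difference between true and sampled regrets is a martingale in each window, but
windows start at random times, their number is not known in advance, and the tolerated deviation
depends on the restricted game. All windows are handled at once by a single nonnegative
supermartingale (`failurePotential`): the sum of the exponential supermartingales of the present
window, scaled by the failure probability `p / ((j + 1) (j + 2))` granted to it, plus a reserve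
`p / (j + 2)` for the windows to come, which pays for the next window when this one ends. It starts
at most at `p`, so by Ville's inequality (`measure_exists_one_le_le`) it stays below `1` with
probability at least `1 - p`.

*Accounting.* On that event a window `j` with a restricted game of size `X_j` is over, or an
equilibrium is found, at the first oracle call after `O(X_j² |A_j| log / ε²)` iterations
(`sub_windowStart_le`). As iterations cost at most `2 H_j` and oracle calls `X_j`, the frequency
`m(j)` makes the cost of a window `O((|A| H X_j² / ε² + 2 √(|A| H) X_j^{1.5} / ε) log)`
(`window_cost_le`). Populations only grow, so each of the `k` windows is bounded by the last one
(`cost_run_le`), and there are finitely many of them (`exists_windowStart_eq`).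
-/

noncomputable section

open scoped Classical

set_option linter.unusedSectionVars false

namespace EFG

variable {Act Info : Type*} [Fintype Act] [Fintype Info] (G : EFG Act Info)

/-! ### Products along paths -/

section PathProd

variable {f g : List Act → Act → ℝ}

lemma pathProd_self (f : List Act → Act → ℝ) (h : List Act) : pathProd f h h = 1 := by
  cases h <;> simp [pathProd]

lemma pathProd_cons_of_ne {h z : List Act} {a : Act} (hne : h ≠ a :: z) :
    pathProd f h (a :: z) = f z a * pathProd f h z := by
  simp [pathProd, hne]

lemma pathProd_nil_cons (f : List Act → Act → ℝ) (z : List Act) (a : Act) :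
    pathProd f [] (a :: z) = f z a * pathProd f [] z := by
  simp [pathProd]

lemma pathProd_eq_zero {h z : List Act} (hz : ¬ h <:+ z) : pathProd f h z = 0 := by
  induction z with
  | nil => 
    have : h ≠ [] := by rintro rfl; simp at hz
    simp [pathProd, this]
  | cons a z ih =>
    rw [List.suffix_cons_iff, not_or] at hz
    rw [pathProd_cons_of_ne hz.1, ih hz.2, mul_zero]

lemma pathProd_mul (f g : List Act → Act → ℝ) (h z : List Act) :
    pathProd (fun h a => f h a * g h a) h z = pathProd f h z * pathProd g h z := by
  induction z with
  | nil => by_cases hh : h = [] <;> simp [pathProd, hh]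
  | cons a z ih =>
    by_cases hh : h = a :: z
    · simp [pathProd, hh]
    · rw [pathProd_cons_of_ne hh, pathProd_cons_of_ne hh, pathProd_cons_of_ne hh, ih]; ring

lemma pathProd_nonneg (hf : ∀ h a, 0 ≤ f h a) (h z : List Act) : 0 ≤ pathProd f h z := by
  induction z with
  | nil => unfold pathProd; split_ifs <;> norm_num
  | cons a z ih =>
    unfold pathProd
    split_ifs
    · norm_num
    · exact mul_nonneg (hf _ _) ih

lemma pathProd_mono (hf : ∀ h a, 0 ≤ f h a) (hfg : ∀ h a, f h a ≤ g h a) (h z : List Act) :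
    pathProd f h z ≤ pathProd g h z := by
  induction z with
  | nil => simp [pathProd]
  | cons a z ih =>
    unfold pathProd
    split_ifs
    · exact le_rfl
    · exact mul_le_mul (hfg _ _) ih (pathProd_nonneg hf _ _) ((hf _ _).trans (hfg _ _))

lemma pathProd_trans {h z : List Act} (hz : h <:+ z) :
    pathProd f [] h * pathProd f h z = pathProd f [] z := by
  induction z with
  | nil => rw [List.suffix_nil] at hz; subst hz; simp [pathProd]
  | cons a z ih =>
    by_cases hh : h = a :: z
    · rw [hh, pathProd_self, mul_one]
    · rw [List.suffix_cons_iff] at hz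
      rw [pathProd_cons_of_ne hh, pathProd_nil_cons, ← ih (hz.resolve_left hh)]; ring

lemma pathProd_eq_sum_first_step {h z : List Act} (hne : h ≠ z) :
    pathProd f h z = ∑ a, f h a * pathProd f (a :: h) z := by
  induction z with
  | nil => simp [pathProd, hne]
  | cons b z ih =>
    rw [pathProd_cons_of_ne hne]
    by_cases hh : h = z
    · subst hh
      rw [pathProd_self, Finset.sum_eq_single b]
      · rw [pathProd_self]
      · intro a _ hab
        rw [pathProd_eq_zero, mul_zero]
        intro hs
        have := hs.eq_of_length (by simp)
        simp_all
      · simp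
    · rw [ih hh, Finset.mul_sum]
      refine Finset.sum_congr rfl fun a _ => ?_
      rw [pathProd_cons_of_ne (by simp_all)]
      ring

/-- Telescoping: the step factors of a path are exchanged one at a time. -/
lemma pathProd_sub_pathProd (f g : List Act → Act → ℝ) (S : Finset (List Act))
    (hS : ∀ a h, a :: h ∈ S → h ∈ S) (z : List Act) (hz : z ∈ S) :
    pathProd f [] z - pathProd g [] z =
      ∑ h ∈ S, ∑ a, pathProd f [] h * (f h a - g h a) * pathProd g (a :: h) z := by
  induction z with
  | nil =>
    simp [pathProd]
  | cons b z ih =>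
    have hz' := hS _ _ hz
    have key : ∀ h a, pathProd f [] h * (f h a - g h a) * pathProd g (a :: h) (b :: z) =
        (if h = z then if a = b then pathProd f [] z * (f z b - g z b) else 0 else 0) +
        g z b * (pathProd f [] h * (f h a - g h a) * pathProd g (a :: h) z) := by
      intro h a
      by_cases hh : a :: h = b :: z
      · obtain ⟨rfl, rfl⟩ := List.cons_eq_cons.1 hh
        have h0 : pathProd g (a :: h) h = 0 := pathProd_eq_zero fun hs => by
          have := hs.length_le
          simp at this
        rw [pathProd_self, h0]; simp
      · rw [pathProd_cons_of_ne hh]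
        have : (if h = z then
            if a = b then pathProd f [] z * (f z b - g z b) else 0 else 0) = 0 := by
          split_ifs with h1 h2
          · simp_all
          · rfl
          · rfl
        rw [this]; ring
    simp_rw [key, Finset.sum_add_distrib, ← Finset.mul_sum]
    rw [← ih hz', Finset.sum_eq_single z]
    · simp [pathProd_nil_cons]; ring
    · intro h _ hh; simp [hh]
    · intro h; exact absurd hz' h

end PathProd

/-! ### Reaching probabilities -/

lemma mem_hist_of_suffix {h z : List Act} (hs : h <:+ z) (hz : z ∈ G.hist) : h ∈ G.hist := by
  induction z with
  | nil => rw [List.suffix_nil] at hs; subst hs; exact hz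
  | cons a z ih =>
    rcases List.suffix_cons_iff.1 hs with rfl | hs
    · exact hz
    · exact ih hs (G.tail_mem _ _ hz)

lemma mem_terminals {z : List Act} : z ∈ G.terminals ↔ z ∈ G.hist ∧ ∀ a, a :: z ∉ G.hist := by
  simp [terminals]

lemma mem_nodes {s : Info} {h : List Act} :
    h ∈ G.nodes s ↔ h ∈ G.hist ∧ (∃ b, b :: h ∈ G.hist) ∧ G.info h = some s := by
  simp [nodes]

lemma mem_nodes_of_cons {s : Info} {h : List Act} {a : Act} (hh : a :: h ∈ G.hist)
    (hs : G.info h = some s) : h ∈ G.nodes s :=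
  G.mem_nodes.2 ⟨G.tail_mem _ _ hh, ⟨a, hh⟩, hs⟩

lemma ne_of_mem_nodes {s : Info} {h z : List Act} (hh : h ∈ G.nodes s) (hz : z ∈ G.terminals) :
    h ≠ z := by
  rintro rfl
  obtain ⟨_, ⟨b, hb⟩, _⟩ := G.mem_nodes.1 hh
  exact (G.mem_terminals.1 hz).2 b hb

lemma eq_of_terminal_suffix {h z : List Act} (hh : h ∈ G.terminals) (hs : h <:+ z)
    (hz : z ∈ G.hist) : h = z := by
  induction z with
  | nil => exact List.suffix_nil.1 hs
  | cons a z ih =>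
    rcases List.suffix_cons_iff.1 hs with rfl | hs
    · rfl
    · have := ih hs (G.tail_mem _ _ hz)
      subst this
      exact absurd hz ((G.mem_terminals.1 hh).2 a)

lemma IsStrategyOn.le_one {P : Info → Finset Act} {σ : Info → Act → ℝ}
    (hσ : IsStrategyOn P σ) (s : Info) (a : Act) : σ s a ≤ 1 := by
  rw [← (hσ s).2.2]
  exact Finset.single_le_sum (fun b _ => (hσ s).1 b) (Finset.mem_univ a)

lemma IsStrategyOn.mono {P Q : Info → Finset Act} {σ : Info → Act → ℝ}
    (hσ : IsStrategyOn P σ) (hPQ : ∀ s, P s ⊆ Q s) : IsStrategyOn Q σ :=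
  fun s => ⟨(hσ s).1, fun a ha => (hσ s).2.1 a fun h => ha (hPQ s h), (hσ s).2.2⟩

lemma IsStrategyOn.sum_eq_one {P : Info → Finset Act} {σ : Info → Act → ℝ}
    (hσ : IsStrategyOn P σ) (s : Info) : ∑ a ∈ P s, σ s a = 1 := by
  rw [← (hσ s).2.2]
  exact Finset.sum_subset (Finset.subset_univ _) fun a _ ha => (hσ s).2.1 a ha

lemma IsStrategyOn.deviate {P : Info → Finset Act} {σ τ : Info → Act → ℝ}
    (hσ : IsStrategyOn P σ) (hτ : IsStrategyOn P τ) (i : Fin 2) :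
    IsStrategyOn P (G.deviate i τ σ) := by
  intro s
  unfold EFG.deviate
  split_ifs
  · exact hτ s
  · exact hσ s

/-- The contribution of chance to the probability of getting from `h` to `z`. -/
def chanceFrom (h z : List Act) : ℝ :=
  pathProd (fun h a => match G.info h with
    | some _ => 1
    | none => G.chance h a) h z

lemma chanceFrom_nonneg (h z : List Act) : 0 ≤ G.chanceFrom h z := by
  refine pathProd_nonneg (fun h a => ?_) _ _
  cases G.info h
  · exact G.chance_nonneg h a
  · exact zero_le_one

lemma stepProb_nonneg {σ : Info → Act → ℝ} (hσ : ∀ s a, 0 ≤ σ s a) (h : List Act) (a : Act) :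
    0 ≤ G.stepProb σ h a := by
  unfold stepProb
  cases G.info h
  · exact G.chance_nonneg h a
  · exact hσ _ _

lemma reachFrom_nonneg {σ : Info → Act → ℝ} (hσ : ∀ s a, 0 ≤ σ s a) (h z : List Act) :
    0 ≤ G.reachFrom σ h z := pathProd_nonneg (G.stepProb_nonneg hσ) _ _

lemma reachFrom_le_chanceFrom {σ : Info → Act → ℝ} (hσ : ∀ s a, 0 ≤ σ s a)
    (hσ' : ∀ s a, σ s a ≤ 1) (h z : List Act) : G.reachFrom σ h z ≤ G.chanceFrom h z := by
  refine pathProd_mono (G.stepProb_nonneg hσ) (fun h a => ?_) _ _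
  unfold stepProb
  cases G.info h
  · exact le_rfl
  · exact hσ' _ _

lemma ownReach_cons (σ : Info → Act → ℝ) (i : Fin 2) (h : List Act) (a : Act) :
    G.ownReach σ i (a :: h) = (match G.info h with
      | some s => if G.owner s = i then σ s a else 1
      | none => 1) * G.ownReach σ i h := by
  refine (pathProd_nil_cons _ _ _).trans ?_
  cases G.info h <;> rfl

/-- The contribution of a player to the reaching probability only depends on the experience of
that player. -/
lemma ownReach_eq_prod_experience (σ : Info → Act → ℝ) (i : Fin 2) (h : List Act) :
    G.ownReach σ i h = ((G.experience i h).map fun q => σ q.1 q.2).prod := by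
  induction h with
  | nil => simp [ownReach, experience, pathProd]
  | cons a h ih =>
    rw [ownReach_cons, ih]
    cases hs : G.info h with
    | none => simp [experience, hs]
    | some s => by_cases ho : G.owner s = i <;> simp [experience, hs, ho]

lemma ownReach_nonneg {σ : Info → Act → ℝ} (hσ : ∀ s a, 0 ≤ σ s a) (i : Fin 2) (h : List Act) :
    0 ≤ G.ownReach σ i h := by
  refine pathProd_nonneg (fun h a => ?_) _ _
  cases G.info h
  · exact zero_le_one
  · dsimp only; split_ifs
    · exact hσ _ _
    · exact zero_le_one

lemma ownReach_le_one {σ : Info → Act → ℝ} (hσ : ∀ s a, 0 ≤ σ s a) (hσ' : ∀ s a, σ s a ≤ 1)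
    (i : Fin 2) (h : List Act) : G.ownReach σ i h ≤ 1 := by
  induction h with
  | nil => simp [ownReach, pathProd]
  | cons a h ih =>
    rw [ownReach_cons]
    refine mul_le_one₀ ?_ (G.ownReach_nonneg hσ i h) ih
    cases G.info h
    · exact le_rfl
    · dsimp only; split_ifs
      · exact hσ' _ _
      · exact le_rfl

lemma ownReach_congr {σ τ : Info → Act → ℝ} {i : Fin 2} (hστ : ∀ s, G.owner s = i → σ s = τ s)
    (h : List Act) : G.ownReach σ i h = G.ownReach τ i h := by
  induction h with
  | nil => simp [ownReach, pathProd]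
  | cons a h ih =>
    rw [ownReach_cons, ownReach_cons, ih]
    cases hs : G.info h with
    | none => rfl
    | some s =>
      by_cases ho : G.owner s = i
      · simp [ho, hστ s ho]
      · simp [ho]

lemma reach_eq_ownReach_mul_cfReach (σ : Info → Act → ℝ) (i : Fin 2) (z : List Act) :
    G.reach σ z = G.ownReach σ i z * G.cfReach σ i z := by
  unfold reach reachFrom ownReach cfReach
  rw [← pathProd_mul]
  congr 1
  funext h a
  unfold stepProb
  cases G.info h with
  | none => simp
  | some s => dsimp only; split_ifs <;> simp

lemma cfReach_eq_ownReach_mul_chanceFrom (σ : Info → Act → ℝ) {i j : Fin 2} (hij : i ≠ j)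
    (z : List Act) : G.cfReach σ i z = G.ownReach σ j z * G.chanceFrom [] z := by
  unfold cfReach ownReach chanceFrom
  rw [← pathProd_mul]
  congr 1
  funext h a
  cases G.info h with
  | none => simp
  | some s =>
    have h1 : G.owner s = j ↔ ¬ G.owner s = i := by omega
    by_cases ho : G.owner s = i <;> simp [ho, h1, hij]

lemma reach_eq_prod_mul_chanceFrom (σ : Info → Act → ℝ) (z : List Act) :
    G.reach σ z = (∏ i, G.ownReach σ i z) * G.chanceFrom [] z := by
  rw [G.reach_eq_ownReach_mul_cfReach σ 0,
    G.cfReach_eq_ownReach_mul_chanceFrom σ (show (0 : Fin 2) ≠ 1 by decide), Fin.prod_univ_two]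
  ring

lemma cfReach_nonneg {σ : Info → Act → ℝ} (hσ : ∀ s a, 0 ≤ σ s a) (i : Fin 2) (h : List Act) :
    0 ≤ G.cfReach σ i h := by
  obtain ⟨j, hj⟩ := exists_ne i
  rw [G.cfReach_eq_ownReach_mul_chanceFrom σ hj.symm]
  exact mul_nonneg (G.ownReach_nonneg hσ _ _) (G.chanceFrom_nonneg _ _)

lemma cfReach_congr {σ τ : Info → Act → ℝ} {i : Fin 2} (hστ : ∀ s, G.owner s ≠ i → σ s = τ s)
    (h : List Act) : G.cfReach σ i h = G.cfReach τ i h := by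
  obtain ⟨j, hj⟩ := exists_ne i
  rw [G.cfReach_eq_ownReach_mul_chanceFrom σ hj.symm,
    G.cfReach_eq_ownReach_mul_chanceFrom τ hj.symm,
    G.ownReach_congr fun s hs => hστ s (by rw [hs]; exact hj)]

lemma reach_deviate (τ σ : Info → Act → ℝ) (i : Fin 2) (z : List Act) :
    G.reach (G.deviate i τ σ) z = G.ownReach τ i z * G.cfReach σ i z := by
  rw [G.reach_eq_ownReach_mul_cfReach _ i]
  congr 1
  · exact G.ownReach_congr (fun s hs => by simp [deviate, hs]) z
  · exact G.cfReach_congr (fun s hs => by simp [deviate, hs]) z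

lemma sum_stepProb {σ : Info → Act → ℝ} (hσ : G.IsStrategy σ) {h : List Act}
    (hh : h ∈ G.hist) (hne : ∃ b, b :: h ∈ G.hist) : ∑ a, G.stepProb σ h a = 1 := by
  unfold stepProb
  cases hs : G.info h with
  | none => exact G.chance_sum h hh hne hs
  | some s => exact (hσ s).2.2

lemma stepProb_eq_zero {σ : Info → Act → ℝ} (hσ : G.IsStrategy σ) {h : List Act}
    (hh : h ∈ G.hist) (hne : ∃ b, b :: h ∈ G.hist) {a : Act} (ha : a :: h ∉ G.hist) :
    G.stepProb σ h a = 0 := by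
  unfold stepProb
  cases hs : G.info h with
  | none => exact G.chance_support h a ha
  | some s => exact (hσ s).2.1 a fun h' => ha ((G.mem_acts h hh hne s hs a).1 h')

/-- From every history some terminal history is reached with probability one. -/
lemma sum_reachFrom_terminals {σ : Info → Act → ℝ} (hσ : G.IsStrategy σ) {h : List Act}
    (hh : h ∈ G.hist) : ∑ z ∈ G.terminals, G.reachFrom σ h z = 1 := by
  obtain ⟨n, hn⟩ : ∃ n, G.hist.sup List.length - h.length = n := ⟨_, rfl⟩
  induction n using Nat.strong_induction_on generalizing h with
  | _ n ih =>
  by_cases hne : ∃ b, b :: h ∈ G.hist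
  · have hne' : ∀ z ∈ G.terminals, G.reachFrom σ h z =
        ∑ a, G.stepProb σ h a * G.reachFrom σ (a :: h) z := by
      intro z hz
      refine pathProd_eq_sum_first_step ?_
      rintro rfl
      obtain ⟨b, hb⟩ := hne
      exact (G.mem_terminals.1 hz).2 b hb
    rw [Finset.sum_congr rfl hne', Finset.sum_comm, ← G.sum_stepProb hσ hh hne]
    refine Finset.sum_congr rfl fun a _ => ?_
    rw [← Finset.mul_sum]
    by_cases ha : a :: h ∈ G.hist
    · have hl : (a :: h).length ≤ G.hist.sup List.length := Finset.le_sup (f := List.length) ha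
      rw [List.length_cons] at hl
      rw [ih _ (by rw [← hn, List.length_cons]; omega) ha rfl, mul_one]
    · rw [G.stepProb_eq_zero hσ hh hne ha, zero_mul]
  · have ht : h ∈ G.terminals := G.mem_terminals.2 ⟨hh, fun a ha => hne ⟨a, ha⟩⟩
    rw [Finset.sum_eq_single h]
    · exact pathProd_self _ _
    · intro z hz hzh
      exact pathProd_eq_zero fun hs =>
        hzh (G.eq_of_terminal_suffix ht hs (G.mem_terminals.1 hz).1).symm
    · exact fun h' => absurd ht h'

lemma sum_reach_terminals {σ : Info → Act → ℝ} (hσ : G.IsStrategy σ) :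
    ∑ z ∈ G.terminals, G.reach σ z = 1 := G.sum_reachFrom_terminals hσ G.nil_mem

/-! ### Counterfactual values and the performance difference -/

/-- The value for player `i` of continuing with `σ` from the history `h`. -/
def continuation (σ : Info → Act → ℝ) (i : Fin 2) (h : List Act) : ℝ :=
  ∑ z ∈ G.terminals, G.reachFrom σ h z * G.util i z

/-- The immediate counterfactual regret for not playing `a` at `s`. -/
def cfRegret (σ : Info → Act → ℝ) (s : Info) (a : Act) : ℝ :=
  ∑ h ∈ G.nodes s, G.cfReach σ (G.owner s) h *
    (G.continuation σ (G.owner s) (a :: h) - G.continuation σ (G.owner s) h)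

lemma continuation_eq_sum (σ : Info → Act → ℝ) (i : Fin 2) {s : Info} {h : List Act}
    (hh : h ∈ G.nodes s) :
    G.continuation σ i h = ∑ a, σ s a * G.continuation σ i (a :: h) := by
  unfold continuation
  simp_rw [Finset.mul_sum]
  rw [Finset.sum_comm]
  refine Finset.sum_congr rfl fun z hz => ?_
  unfold reachFrom
  rw [pathProd_eq_sum_first_step (G.ne_of_mem_nodes hh hz), Finset.sum_mul]
  refine Finset.sum_congr rfl fun a _ => ?_
  simp [stepProb, (G.mem_nodes.1 hh).2.2, mul_assoc]

lemma continuation_eq_zero (σ : Info → Act → ℝ) (i : Fin 2) {h : List Act} (hh : h ∉ G.hist) :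
    G.continuation σ i h = 0 :=
  Finset.sum_eq_zero fun z hz => by
    unfold reachFrom
    rw [pathProd_eq_zero, zero_mul]
    exact fun hs => hh (G.mem_hist_of_suffix hs (G.mem_terminals.1 hz).1)

/-- The gain of player `i` from deviating to `τ` is the sum over the nodes of this player of the
advantages of `τ` over `σ`, weighted with the probability that the deviation reaches the node. -/
lemma value_deviate_sub_value {τ σ : Info → Act → ℝ} (hτ : G.IsStrategy τ) (i : Fin 2) :
    G.value (G.deviate i τ σ) i - G.value σ i =
      ∑ s with G.owner s = i, ∑ h ∈ G.nodes s, G.ownReach τ i h * G.cfReach σ i h *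
        ∑ a, τ s a * (G.continuation σ i (a :: h) - G.continuation σ i h) := by
  set σ' := G.deviate i τ σ with hσ'
  have h1 : G.value σ' i - G.value σ i = ∑ h ∈ G.hist, G.reach σ' h *
      ∑ a, (G.stepProb σ' h a - G.stepProb σ h a) * G.continuation σ i (a :: h) := by
    unfold value
    rw [← Finset.sum_sub_distrib]
    have : ∀ z ∈ G.terminals, G.reach σ' z * G.util i z - G.reach σ z * G.util i z =
        ∑ h ∈ G.hist, ∑ a, G.reach σ' h * (G.stepProb σ' h a - G.stepProb σ h a) *
          (G.reachFrom σ (a :: h) z * G.util i z) := by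
      intro z hz
      rw [← sub_mul]
      unfold reach reachFrom
      rw [pathProd_sub_pathProd _ _ G.hist G.tail_mem z (G.mem_terminals.1 hz).1,
        Finset.sum_mul]
      refine Finset.sum_congr rfl fun h _ => ?_
      rw [Finset.sum_mul]
      exact Finset.sum_congr rfl fun a _ => by ring
    rw [Finset.sum_congr rfl this, Finset.sum_comm]
    refine Finset.sum_congr rfl fun h _ => ?_
    rw [Finset.sum_comm, Finset.mul_sum]
    refine Finset.sum_congr rfl fun a _ => ?_
    rw [← Finset.mul_sum, mul_assoc]
    rfl
  rw [h1]
  have h2 : ∀ s, G.owner s = i → ∀ h ∈ G.nodes s, G.ownReach τ i h * G.cfReach σ i h *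
        ∑ a, τ s a * (G.continuation σ i (a :: h) - G.continuation σ i h) =
      G.reach σ' h *
        ∑ a, (G.stepProb σ' h a - G.stepProb σ h a) * G.continuation σ i (a :: h) := by
    intro s hs h hh
    rw [hσ', reach_deviate]
    congr 1
    simp_rw [mul_sub, sub_mul, Finset.sum_sub_distrib]
    rw [← Finset.sum_mul, (hτ s).2.2, one_mul, G.continuation_eq_sum σ i hh]
    simp [stepProb, (G.mem_nodes.1 hh).2.2, deviate, hs]
  rw [Finset.sum_congr rfl fun s hs => Finset.sum_congr rfl (h2 s (Finset.mem_filter.1 hs).2)]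
  rw [← Finset.sum_biUnion]
  · symm
    refine Finset.sum_subset (fun h hh => ?_) fun h hh hn => ?_
    · obtain ⟨s, _, hs⟩ := Finset.mem_biUnion.1 hh
      exact (G.mem_nodes.1 hs).1
    · rw [Finset.sum_eq_zero, mul_zero]
      intro a _
      by_cases ha : a :: h ∈ G.hist
      · cases hs : G.info h with
        | none => simp [stepProb, hs]
        | some s =>
          have ho : G.owner s ≠ i := fun ho => hn (Finset.mem_biUnion.2
            ⟨s, by simp [ho], G.mem_nodes_of_cons ha hs⟩)
          simp [stepProb, hs, hσ', deviate, ho]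
      · rw [G.continuation_eq_zero _ _ ha, mul_zero]
  · intro s _ s' _ hss
    refine Finset.disjoint_left.2 fun h hh hh' => hss ?_
    have h3 := (G.mem_nodes.1 hh).2.2
    rw [(G.mem_nodes.1 hh').2.2] at h3
    exact (Option.some.inj h3).symm

end EFG

namespace EFG

variable {Act Info : Type*} [Fintype Act] [Fintype Info] (G : EFG Act Info)

/-! ### Restricted games -/

variable {P : Info → Finset Act}

lemma mem_restrInfosets {i : Fin 2} {s : Info} :
    s ∈ G.restrInfosets P i ↔ G.owner s = i ∧ ∃ h ∈ G.nodes s, G.Allowed P h := by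
  simp [restrInfosets]

lemma allowed_iff_forall_experience {h : List Act} :
    G.Allowed P h ↔ ∀ i, ∀ q ∈ G.experience i h, q.2 ∈ P q.1 := by
  induction h with
  | nil => simp [Allowed, experience]
  | cons a h ih =>
    unfold Allowed
    rw [ih]
    cases hs : G.info h with
    | none => simp [experience, hs]
    | some s =>
      constructor
      · rintro ⟨h1, h2⟩ i q hq
        by_cases ho : G.owner s = i
        · simp only [experience, hs, ho, if_true, List.mem_cons] at hq
          rcases hq with rfl | hq
          · exact h2 s rfl
          · exact h1 i q hq
        · simp only [experience, hs, ho, if_false] at hq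
          exact h1 i q hq
      · intro h1
        refine ⟨fun i q hq => h1 i q ?_, ?_⟩
        · simp only [experience, hs]
          split_ifs
          · exact List.mem_cons_of_mem _ hq
          · exact hq
        · rintro s' hs'
          obtain rfl := Option.some.inj hs'
          exact h1 (G.owner s) (s, a) (by simp [experience, hs])

lemma mem_of_ownReach_ne_zero {σ : Info → Act → ℝ} (hσ : IsStrategyOn P σ) {i : Fin 2}
    {h : List Act} (hne : G.ownReach σ i h ≠ 0) {q : Info × Act} (hq : q ∈ G.experience i h) :
    q.2 ∈ P q.1 := by
  by_contra hn
  refine hne ?_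
  rw [ownReach_eq_prod_experience]
  exact List.prod_eq_zero (List.mem_map.2 ⟨q, hq, (hσ q.1).2.1 _ hn⟩)

lemma allowed_of_reach_ne_zero {σ : Info → Act → ℝ} (hσ : IsStrategyOn P σ) {h : List Act}
    (hne : G.reach σ h ≠ 0) : G.Allowed P h := by
  rw [allowed_iff_forall_experience]
  intro i q hq
  rw [reach_eq_ownReach_mul_cfReach G σ i] at hne
  exact G.mem_of_ownReach_ne_zero hσ (left_ne_zero_of_mul hne) hq

/-- By perfect recall, the owner of an information set of the restricted game has only used
available actions on the way to any of its histories. -/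
lemma allowed_of_cfReach_ne_zero (hG : G.PerfectRecall) {σ : Info → Act → ℝ}
    (hσ : IsStrategyOn P σ) {s : Info} (hs : s ∈ G.restrInfosets P (G.owner s)) {h : List Act}
    (hh : h ∈ G.nodes s) (hne : G.cfReach σ (G.owner s) h ≠ 0) : G.Allowed P h := by
  obtain ⟨_, h', hh', ha⟩ := G.mem_restrInfosets.1 hs
  rw [allowed_iff_forall_experience] at ha ⊢
  intro i q hq
  by_cases hi : i = G.owner s
  · subst hi
    rw [hG s h hh h' hh'] at hq
    exact ha _ q hq
  · rw [G.cfReach_eq_ownReach_mul_chanceFrom σ (Ne.symm hi)] at hne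
    exact G.mem_of_ownReach_ne_zero hσ (left_ne_zero_of_mul hne) hq

lemma allowed_of_reachFrom_ne_zero {σ : Info → Act → ℝ} (hσ : IsStrategyOn P σ)
    {g z : List Act} (hg : G.Allowed P g) (hne : G.reachFrom σ g z ≠ 0) : G.Allowed P z := by
  induction z with
  | nil => trivial
  | cons a z ih =>
    by_cases hz : g = a :: z
    · exact hz ▸ hg
    · unfold reachFrom at hne
      rw [pathProd_cons_of_ne hz] at hne
      refine ⟨ih (right_ne_zero_of_mul hne), fun s hs => ?_⟩
      by_contra hn
      refine left_ne_zero_of_mul hne ?_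
      simp [stepProb, hs, (hσ s).2.1 a hn]

lemma experience_suffix (i : Fin 2) {h z : List Act} (hz : h <:+ z) :
    G.experience i h <:+ G.experience i z := by
  induction z with
  | nil => rw [List.suffix_nil.1 hz]
  | cons a z ih =>
    rcases List.suffix_cons_iff.1 hz with rfl | hz
    · exact List.suffix_rfl
    · refine (ih hz).trans ?_
      cases hs : G.info z with
      | none => simp [experience, hs]
      | some s =>
        simp only [experience, hs]
        split_ifs
        · exact List.suffix_cons _ _
        · exact List.suffix_rfl

/-- By perfect recall, a trajectory passes through an information set at most once. -/
lemma node_eq_of_suffix (hG : G.PerfectRecall) {s : Info} {h h' z : List Act}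
    (hh : h ∈ G.nodes s) (hh' : h' ∈ G.nodes s) (hz : h <:+ z) (hz' : h' <:+ z) : h = h' := by
  wlog hs : h <:+ h' generalizing h h'
  · exact (this hh' hh hz' hz ((List.suffix_or_suffix_of_suffix hz hz').resolve_left hs)).symm
  by_contra hne
  obtain ⟨l, hl⟩ := hs
  rcases List.eq_nil_or_concat l with rfl | ⟨l', a, rfl⟩
  · exact hne (by simpa using hl)
  · have h1 : a :: h <:+ h' := ⟨l', by simpa using hl⟩
    have h2 := (G.experience_suffix (G.owner s) h1).length_le
    rw [hG s h' hh' h hh] at h2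
    simp [experience, (G.mem_nodes.1 hh).2.2] at h2

/-! ### Sampled counterfactual regrets -/

/-- The exploration condition bounds the importance weights: what the current strategy contributes
between an information set and the end of the game is at most `1 / δ` times the sampling
probability. In particular it vanishes if the trajectory cannot be sampled. -/
lemma cfReach_mul_reachFrom_le (hG : G.PerfectRecall) {δ : ℝ} (hδ : 0 < δ)
    {σ η : Info → Act → ℝ} (hσ : IsStrategyOn P σ) (hη : IsStrategyOn P η)
    {z : List Act} (hz : G.Allowed P z → δ ≤ ∏ i, G.ownReach η i z)
    {s : Info} (hs : s ∈ G.restrInfosets P (G.owner s)) {h g : List Act} (hh : h ∈ G.nodes s)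
    (hg : g = h ∨ ∃ a ∈ P s, g = a :: h) :
    G.cfReach σ (G.owner s) h * G.reachFrom σ g z ≤ G.reach η z / δ := by
  have hσ0 : ∀ s a, 0 ≤ σ s a := fun s => (hσ s).1
  have hη0 : ∀ s a, 0 ≤ η s a := fun s => (hη s).1
  have hR : 0 ≤ G.reach η z := G.reachFrom_nonneg hη0 _ _
  by_cases hne : G.cfReach σ (G.owner s) h * G.reachFrom σ g z = 0
  · rw [hne]; positivity
  have h1 := left_ne_zero_of_mul hne
  have h2 := right_ne_zero_of_mul hne
  have hah := G.allowed_of_cfReach_ne_zero hG hσ hs hh h1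
  have hinfo := (G.mem_nodes.1 hh).2.2
  have hag : G.Allowed P g := by
    rcases hg with rfl | ⟨a, ha, rfl⟩
    · exact hah
    · exact ⟨hah, fun s' hs' => by rw [hinfo] at hs'; obtain rfl := Option.some.inj hs'; exact ha⟩
  have haz := G.allowed_of_reachFrom_ne_zero hσ hag h2
  have hgz : g <:+ z := by
    by_contra hn
    exact h2 (pathProd_eq_zero hn)
  have hc : G.chanceFrom [] h = G.chanceFrom [] g := by
    rcases hg with rfl | ⟨a, _, rfl⟩
    · rfl
    · unfold chanceFrom
      rw [pathProd_nil_cons]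
      simp [hinfo]
  obtain ⟨j, hj⟩ := exists_ne (G.owner s)
  have h3 : G.cfReach σ (G.owner s) h ≤ G.chanceFrom [] g := by
    rw [G.cfReach_eq_ownReach_mul_chanceFrom σ hj.symm, hc]
    exact mul_le_of_le_one_left (G.chanceFrom_nonneg _ _)
      (G.ownReach_le_one hσ0 hσ.le_one _ _)
  have h4 : G.reachFrom σ g z ≤ G.chanceFrom g z :=
    G.reachFrom_le_chanceFrom hσ0 hσ.le_one _ _
  have h5 : G.chanceFrom [] g * G.chanceFrom g z = G.chanceFrom [] z := pathProd_trans hgz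
  rw [le_div_iff₀ hδ]
  calc G.cfReach σ (G.owner s) h * G.reachFrom σ g z * δ
      ≤ G.chanceFrom [] g * G.chanceFrom g z * δ := by
        gcongr
        · exact G.reachFrom_nonneg hσ0 _ _
        · exact G.chanceFrom_nonneg _ _
    _ = δ * G.chanceFrom [] z := by rw [h5, mul_comm]
    _ ≤ (∏ i, G.ownReach η i z) * G.chanceFrom [] z :=
        mul_le_mul_of_nonneg_right (hz haz) (G.chanceFrom_nonneg _ _)
    _ = G.reach η z := (G.reach_eq_prod_mul_chanceFrom η z).symm

lemma abs_util_le {Δ : ℝ} (hΔ : ∀ z ∈ G.terminals, |G.payoff z| ≤ Δ) (i : Fin 2) {z : List Act}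
    (hz : z ∈ G.terminals) : |G.util i z| ≤ Δ := by
  unfold util
  split_ifs
  · exact hΔ z hz
  · rw [abs_neg]; exact hΔ z hz

lemma abs_sampledRegret_le (hG : G.PerfectRecall) {Δ δ : ℝ} (hδ : 0 < δ)
    (hΔ : ∀ z ∈ G.terminals, |G.payoff z| ≤ Δ)
    {σ η : Info → Act → ℝ} (hσ : IsStrategyOn P σ) (hη : IsStrategyOn P η)
    {z : List Act} (hzt : z ∈ G.terminals) (hz : G.Allowed P z → δ ≤ ∏ i, G.ownReach η i z)
    {s : Info} (hs : s ∈ G.restrInfosets P (G.owner s)) {a : Act} (ha : a ∈ P s) :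
    |G.sampledRegret η σ z s a| ≤ Δ / δ := by
  have hΔ0 : 0 ≤ Δ := (abs_nonneg _).trans (hΔ z hzt)
  have hB : 0 ≤ Δ / δ := by positivity
  have hσ0 : ∀ s a, 0 ≤ σ s a := fun s => (hσ s).1
  have hR : 0 ≤ G.reach η z := G.reachFrom_nonneg (fun s => (hη s).1) _ _
  have hterm : ∀ h ∈ G.nodes s, |G.cfReach σ (G.owner s) h *
      (G.reachFrom σ (a :: h) z - G.reachFrom σ h z) * G.util (G.owner s) z / G.reach η z|
        ≤ Δ / δ := by
    intro h hh
    have hx := G.cfReach_mul_reachFrom_le hG hδ hσ hη hz hs hh (Or.inr ⟨a, ha, rfl⟩)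
    have hy := G.cfReach_mul_reachFrom_le hG hδ hσ hη hz hs hh (Or.inl rfl)
    have hx0 := mul_nonneg (G.cfReach_nonneg hσ0 (G.owner s) h)
      (G.reachFrom_nonneg hσ0 (a :: h) z)
    have hy0 := mul_nonneg (G.cfReach_nonneg hσ0 (G.owner s) h) (G.reachFrom_nonneg hσ0 h z)
    have hd : |G.cfReach σ (G.owner s) h * (G.reachFrom σ (a :: h) z - G.reachFrom σ h z)|
        ≤ G.reach η z / δ := by
      rw [mul_sub, abs_le]; constructor <;> linarith
    rw [abs_div, abs_mul, abs_of_nonneg hR]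
    refine div_le_of_le_mul₀ hR hB ?_
    calc _ ≤ G.reach η z / δ * Δ :=
          mul_le_mul hd (G.abs_util_le hΔ _ hzt) (abs_nonneg _) (by positivity)
      _ = Δ / δ * G.reach η z := by ring
  have hzero : ∀ h ∈ G.nodes s, ¬ h <:+ z → G.cfReach σ (G.owner s) h *
      (G.reachFrom σ (a :: h) z - G.reachFrom σ h z) * G.util (G.owner s) z / G.reach η z
        = 0 := by
    intro h _ hz
    have h1 : G.reachFrom σ h z = 0 := pathProd_eq_zero hz
    have h2 : G.reachFrom σ (a :: h) z = 0 :=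
      pathProd_eq_zero fun h' => hz ((List.suffix_cons a h).trans h')
    rw [h1, h2]; simp
  unfold sampledRegret
  by_cases hex : ∃ h ∈ G.nodes s, h <:+ z
  · obtain ⟨h, hh, hhz⟩ := hex
    rw [Finset.sum_eq_single h]
    · exact hterm h hh
    · intro h' hh' hne
      exact hzero h' hh' fun hs' => hne (G.node_eq_of_suffix hG hh' hh hs' hhz)
    · exact fun h' => absurd hh h'
  · push Not at hex
    rw [Finset.sum_eq_zero fun h hh => hzero h hh (hex h hh), abs_zero]
    exact hB

/-- Sampled counterfactual regrets are unbiased. -/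
lemma sum_reach_mul_sampledRegret (hG : G.PerfectRecall) {δ : ℝ} (hδ : 0 < δ)
    {σ η : Info → Act → ℝ} (hσ : IsStrategyOn P σ) (hη : IsStrategyOn P η)
    (hz : ∀ z ∈ G.terminals, G.Allowed P z → δ ≤ ∏ i, G.ownReach η i z)
    {s : Info} (hs : s ∈ G.restrInfosets P (G.owner s)) {a : Act} (ha : a ∈ P s) :
    ∑ z ∈ G.terminals, G.reach η z * G.sampledRegret η σ z s a = G.cfRegret σ s a := by
  have hσ0 : ∀ s a, 0 ≤ σ s a := fun s => (hσ s).1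
  unfold sampledRegret cfRegret continuation
  simp_rw [← Finset.sum_sub_distrib, Finset.mul_sum]
  rw [Finset.sum_comm]
  refine Finset.sum_congr rfl fun h hh => Finset.sum_congr rfl fun z hzt => ?_
  by_cases hR : G.reach η z = 0
  · have hx := G.cfReach_mul_reachFrom_le hG hδ hσ hη (hz z hzt) hs hh (Or.inr ⟨a, ha, rfl⟩)
    have hy := G.cfReach_mul_reachFrom_le hG hδ hσ hη (hz z hzt) hs hh (Or.inl rfl)
    rw [hR, zero_div] at hx hy
    have hx0 := hx.antisymm (mul_nonneg (G.cfReach_nonneg hσ0 (G.owner s) h)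
      (G.reachFrom_nonneg hσ0 (a :: h) z))
    have hy0 := hy.antisymm (mul_nonneg (G.cfReach_nonneg hσ0 (G.owner s) h)
      (G.reachFrom_nonneg hσ0 h z))
    rw [hR, zero_mul]
    linear_combination (-G.util (G.owner s) z) * hx0 + G.util (G.owner s) z * hy0
  · rw [mul_div_cancel₀ _ hR]; ring

lemma abs_cfRegret_le (hG : G.PerfectRecall) {Δ δ : ℝ} (hδ : 0 < δ)
    (hΔ : ∀ z ∈ G.terminals, |G.payoff z| ≤ Δ) (hP : ∀ s, P s ⊆ G.acts s)
    {σ η : Info → Act → ℝ} (hσ : IsStrategyOn P σ) (hη : IsStrategyOn P η)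
    (hz : ∀ z ∈ G.terminals, G.Allowed P z → δ ≤ ∏ i, G.ownReach η i z)
    {s : Info} (hs : s ∈ G.restrInfosets P (G.owner s)) {a : Act} (ha : a ∈ P s) :
    |G.cfRegret σ s a| ≤ Δ / δ := by
  have hη0 : ∀ z, 0 ≤ G.reach η z := fun z => G.reachFrom_nonneg (fun s => (hη s).1) _ _
  rw [← G.sum_reach_mul_sampledRegret hG hδ hσ hη hz hs ha]
  calc _ ≤ ∑ z ∈ G.terminals, |G.reach η z * G.sampledRegret η σ z s a| :=
        Finset.abs_sum_le_sum_abs _ _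
    _ ≤ ∑ z ∈ G.terminals, G.reach η z * (Δ / δ) := by
        refine Finset.sum_le_sum fun z hzt => ?_
        rw [abs_mul, abs_of_nonneg (hη0 z)]
        exact mul_le_mul_of_nonneg_left
          (G.abs_sampledRegret_le hG hδ hΔ hσ hη hzt (hz z hzt) hs ha) (hη0 z)
    _ = Δ / δ := by
        rw [← Finset.sum_mul, G.sum_reach_terminals (hη.mono hP), one_mul]

lemma sum_mul_sampledRegret {σ η : Info → Act → ℝ} (hσ : IsStrategyOn P σ) {z : List Act}
    (hz : z ∈ G.terminals) (s : Info) : ∑ a ∈ P s, σ s a * G.sampledRegret η σ z s a = 0 := by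
  have h0 : ∑ a ∈ P s, σ s a * G.sampledRegret η σ z s a =
      ∑ a, σ s a * G.sampledRegret η σ z s a :=
    Finset.sum_subset (Finset.subset_univ _) fun a _ ha => by rw [(hσ s).2.1 a ha, zero_mul]
  rw [h0]
  unfold sampledRegret
  simp_rw [Finset.mul_sum]
  rw [Finset.sum_comm]
  refine Finset.sum_eq_zero fun h hh => ?_
  have h1 : G.reachFrom σ h z = ∑ a, σ s a * G.reachFrom σ (a :: h) z := by
    unfold reachFrom
    rw [pathProd_eq_sum_first_step (G.ne_of_mem_nodes hh hz)]
    simp [stepProb, (G.mem_nodes.1 hh).2.2]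
  have h2 : ∑ a, σ s a * (G.reachFrom σ (a :: h) z - G.reachFrom σ h z) = 0 := by
    simp_rw [mul_sub, Finset.sum_sub_distrib]
    rw [← Finset.sum_mul, (hσ s).2.2, one_mul, ← h1, sub_self]
  calc _ = (∑ a, σ s a * (G.reachFrom σ (a :: h) z - G.reachFrom σ h z)) *
        (G.cfReach σ (G.owner s) h * G.util (G.owner s) z / G.reach η z) := by
        rw [Finset.sum_mul]; exact Finset.sum_congr rfl fun a _ => by ring
    _ = 0 := by rw [h2, zero_mul]

/-! ### Regret matching -/

lemma isStrategyOn_uniform (hP : ∀ s, (P s).Nonempty) : IsStrategyOn P (uniform P) := by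
  intro s
  refine ⟨fun a => ?_, fun a ha => by simp [uniform, ha], ?_⟩
  · unfold uniform; split_ifs <;> positivity
  · have : ((P s).card : ℝ) ≠ 0 := by exact_mod_cast (hP s).card_pos.ne'
    simp [uniform, Finset.sum_ite_mem, this]

lemma isStrategyOn_regretMatching (hP : ∀ s, (P s).Nonempty) (R : Info → Act → ℝ) :
    IsStrategyOn P (regretMatching P R) := by
  intro s
  by_cases hS : 0 < ∑ b ∈ P s, max (R s b) 0
  · refine ⟨fun a => ?_, fun a ha => by simp [regretMatching, hS, ha], ?_⟩
    · unfold regretMatching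
      rw [if_pos hS]
      split_ifs
      · exact div_nonneg (le_max_right _ _) hS.le
      · exact le_rfl
    · simp only [regretMatching, if_pos hS, Finset.sum_ite_mem, Finset.univ_inter]
      rw [← Finset.sum_div, div_self hS.ne']
  · have : regretMatching P R s = uniform P s := by
      funext a; simp [regretMatching, hS]
    rw [this]
    exact isStrategyOn_uniform hP s

/-- The potential of regret matching: as the current strategy is proportional to the positive parts
of the cumulative regrets, the cross term vanishes. -/
lemma sum_sq_posPart_add_le {R : Info → Act → ℝ} {s : Info} {r : Act → ℝ}
    (hr : ∑ a ∈ P s, regretMatching P R s a * r a = 0) :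
    ∑ a ∈ P s, max (R s a + r a) 0 ^ 2 ≤
      ∑ a ∈ P s, max (R s a) 0 ^ 2 + ∑ a ∈ P s, r a ^ 2 := by
  have hcross : ∑ a ∈ P s, max (R s a) 0 * r a = 0 := by
    by_cases hS : 0 < ∑ b ∈ P s, max (R s b) 0
    · have : ∀ a ∈ P s, max (R s a) 0 * r a =
          (∑ b ∈ P s, max (R s b) 0) * (regretMatching P R s a * r a) := by
        intro a ha
        simp only [regretMatching, if_pos hS, if_pos ha]
        field_simp
      rw [Finset.sum_congr rfl this, ← Finset.mul_sum, hr, mul_zero]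
    · have h0 : ∀ a ∈ P s, max (R s a) 0 = 0 := by
        have := le_antisymm (not_lt.1 hS) (Finset.sum_nonneg fun b _ => le_max_right _ _)
        exact (Finset.sum_eq_zero_iff_of_nonneg fun b _ => le_max_right _ _).1 this
      exact Finset.sum_eq_zero fun a ha => by rw [h0 a ha, zero_mul]
  have hpt : ∀ a ∈ P s, max (R s a + r a) 0 ^ 2 ≤
      max (R s a) 0 ^ 2 + r a ^ 2 + 2 * (max (R s a) 0 * r a) := by
    intro a _
    have : max (R s a) 0 ^ 2 + r a ^ 2 + 2 * (max (R s a) 0 * r a) = (max (R s a) 0 + r a) ^ 2 := by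
      ring
    rw [this]
    rcases le_total (R s a + r a) 0 with h | h
    · rw [max_eq_right h]; simp; positivity
    · rw [max_eq_left h]
      exact pow_le_pow_left₀ h (by gcongr; exact le_max_left _ _) 2
  refine (Finset.sum_le_sum hpt).trans ?_
  rw [Finset.sum_add_distrib, Finset.sum_add_distrib, ← Finset.mul_sum, hcross]
  simp

/-! ### From counterfactual regrets to equilibria -/

/-- The regret of a player in a restricted game is at most the sum of the counterfactual regrets at
the information sets of the restricted game. -/
lemma sum_value_deviate_sub_le (hG : G.PerfectRecall) (hP : ∀ s, P s ⊆ G.acts s)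
    {τ : Info → Act → ℝ} (hτ : IsStrategyOn P τ) {T : Finset ℕ} {σ : ℕ → Info → Act → ℝ}
    (hσ : ∀ u ∈ T, IsStrategyOn P (σ u)) (i : Fin 2) {Y : ℝ} (hY : 0 ≤ Y)
    (hR : ∀ s ∈ G.restrInfosets P i, ∀ a ∈ P s, ∑ u ∈ T, G.cfRegret (σ u) s a ≤ Y) :
    ∑ u ∈ T, (G.value (G.deviate i τ (σ u)) i - G.value (σ u) i) ≤
      (G.restrInfosets P i).card * Y := by
  have hτ0 : ∀ s a, 0 ≤ τ s a := fun s => (hτ s).1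
  rw [Finset.sum_congr rfl fun u _ => G.value_deviate_sub_value (hτ.mono hP) i,
    Finset.sum_comm]
  have hsub : G.restrInfosets P i ⊆ Finset.univ.filter fun s => G.owner s = i := by
    intro s hs
    simp [(G.mem_restrInfosets.1 hs).1]
  rw [← Finset.sum_subset hsub]
  · rw [← nsmul_eq_mul]
    refine Finset.sum_le_card_nsmul _ _ _ fun s hs => ?_
    obtain ⟨rfl, h₀, hh₀, _⟩ := G.mem_restrInfosets.1 hs
    have h1 : ∀ u ∈ T, ∑ h ∈ G.nodes s, G.ownReach τ (G.owner s) h *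
          G.cfReach (σ u) (G.owner s) h * ∑ a, τ s a *
            (G.continuation (σ u) (G.owner s) (a :: h) - G.continuation (σ u) (G.owner s) h) =
        G.ownReach τ (G.owner s) h₀ * ∑ a ∈ P s, τ s a * G.cfRegret (σ u) s a := by
      intro u _
      have h2 : ∑ a ∈ P s, τ s a * G.cfRegret (σ u) s a = ∑ a, τ s a * G.cfRegret (σ u) s a :=
        Finset.sum_subset (Finset.subset_univ _) fun a _ ha => by rw [(hτ s).2.1 a ha, zero_mul]
      rw [h2]
      unfold cfRegret
      simp_rw [Finset.mul_sum]
      rw [Finset.sum_comm]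
      refine Finset.sum_congr rfl fun a _ => Finset.sum_congr rfl fun h hh => ?_
      rw [G.ownReach_eq_prod_experience, hG s h hh h₀ hh₀, ← G.ownReach_eq_prod_experience]
      ring
    rw [Finset.sum_congr rfl h1, ← Finset.mul_sum, Finset.sum_comm]
    simp_rw [← Finset.mul_sum]
    calc _ ≤ G.ownReach τ (G.owner s) h₀ * ∑ a ∈ P s, τ s a * Y := by
          gcongr with a ha
          · exact G.ownReach_nonneg hτ0 _ _
          · exact hτ0 s a
          · exact hR s hs a ha
      _ = G.ownReach τ (G.owner s) h₀ * Y := by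
          rw [← Finset.sum_mul, hτ.sum_eq_one, one_mul]
      _ ≤ Y := mul_le_of_le_one_left hY (G.ownReach_le_one hτ0 hτ.le_one _ _)
  · intro s hs hn
    refine Finset.sum_eq_zero fun u hu => Finset.sum_eq_zero fun h hh => ?_
    rw [← reach_deviate]
    have : G.reach (G.deviate i τ (σ u)) h = 0 := by
      by_contra hne
      exact hn (G.mem_restrInfosets.2 ⟨(Finset.mem_filter.1 hs).2, h, hh,
        G.allowed_of_reach_ne_zero ((hσ u hu).deviate G hτ i) hne⟩)
    rw [this, zero_mul]

/-- The average of the strategies `σ u`, `u ∈ T`, weighted with their owners' reaching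
probabilities. -/
def averageStrategy (P : Info → Finset Act) (T : Finset ℕ) (σ : ℕ → Info → Act → ℝ) :
    Info → Act → ℝ :=
  let W : Info → Act → ℝ := fun s a =>
    ∑ u ∈ T, (∑ h ∈ G.nodes s, G.ownReach (σ u) (G.owner s) h) * σ u s a
  fun s a => if 0 < ∑ b, W s b then W s a / ∑ b, W s b else uniform P s a

lemma isStrategyOn_averageStrategy (hP : ∀ s, (P s).Nonempty) {T : Finset ℕ}
    {σ : ℕ → Info → Act → ℝ} (hσ : ∀ u ∈ T, IsStrategyOn P (σ u)) :
    IsStrategyOn P (G.averageStrategy P T σ) := by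
  intro s
  set W : Act → ℝ := fun a =>
    ∑ u ∈ T, (∑ h ∈ G.nodes s, G.ownReach (σ u) (G.owner s) h) * σ u s a with hW
  have hW0 : ∀ a, 0 ≤ W a := fun a => Finset.sum_nonneg fun u hu =>
    mul_nonneg (Finset.sum_nonneg fun h _ => G.ownReach_nonneg (fun s => (hσ u hu s).1) _ _)
      ((hσ u hu s).1 a)
  by_cases hS : 0 < ∑ b, W b
  · have h1 : ∀ a, G.averageStrategy P T σ s a = W a / ∑ b, W b := fun a => by
      simp only [averageStrategy]
      rw [if_pos hS]
    refine ⟨fun a => ?_, fun a ha => ?_, ?_⟩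
    · rw [h1]; exact div_nonneg (hW0 a) hS.le
    · have : W a = 0 := Finset.sum_eq_zero fun u hu => by rw [(hσ u hu s).2.1 a ha, mul_zero]
      rw [h1, this, zero_div]
    · simp_rw [h1]
      rw [← Finset.sum_div, div_self hS.ne']
  · have h1 : G.averageStrategy P T σ s = uniform P s := by
      funext a
      simp only [averageStrategy]
      rw [if_neg hS]
    rw [h1]
    exact isStrategyOn_uniform hP s

/-- By perfect recall the average strategy is realization equivalent to playing a uniformly random
one of the averaged strategies. -/
lemma card_mul_ownReach_averageStrategy (hG : G.PerfectRecall) {T : Finset ℕ}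
    {σ : ℕ → Info → Act → ℝ} (hσ : ∀ u ∈ T, IsStrategyOn P (σ u)) (i : Fin 2) {z : List Act}
    (hz : z ∈ G.hist) :
    T.card * G.ownReach (G.averageStrategy P T σ) i z = ∑ u ∈ T, G.ownReach (σ u) i z := by
  induction z with
  | nil => simp [ownReach, pathProd]
  | cons a h ih =>
    have hh := G.tail_mem _ _ hz
    specialize ih hh
    simp_rw [ownReach_cons]
    cases hs : G.info h with
    | none => simpa using ih
    | some s =>
      by_cases ho : G.owner s = i
      swap
      · simpa [ho] using ih
      subst ho
      simp only [if_true]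
      have hn := G.mem_nodes_of_cons hz hs
      have hc : ∀ τ : Info → Act → ℝ, ∑ h' ∈ G.nodes s, G.ownReach τ (G.owner s) h' =
          (G.nodes s).card * G.ownReach τ (G.owner s) h := by
        intro τ
        rw [← nsmul_eq_mul]
        refine Finset.sum_eq_card_nsmul fun h' hh' => ?_
        rw [G.ownReach_eq_prod_experience, hG s h' hh' h hn, ← G.ownReach_eq_prod_experience]
      have hN : (0 : ℝ) < (G.nodes s).card := by exact_mod_cast Finset.card_pos.2 ⟨h, hn⟩
      set x : ℕ → ℝ := fun u => G.ownReach (σ u) (G.owner s) h with hx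
      have hx0 : ∀ u ∈ T, 0 ≤ x u := fun u hu => G.ownReach_nonneg (fun s => (hσ u hu s).1) _ _
      have hW : ∀ b, ∑ u ∈ T, (∑ h ∈ G.nodes s, G.ownReach (σ u) (G.owner s) h) * σ u s b =
          (G.nodes s).card * ∑ u ∈ T, x u * σ u s b := by
        intro b
        rw [Finset.mul_sum]
        exact Finset.sum_congr rfl fun u _ => by rw [hc, mul_assoc]
      have hWs : ∑ b, ∑ u ∈ T, (∑ h ∈ G.nodes s, G.ownReach (σ u) (G.owner s) h) * σ u s b =
          (G.nodes s).card * ∑ u ∈ T, x u := by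
        simp_rw [hW]
        rw [← Finset.mul_sum, Finset.sum_comm]
        congr 1
        refine Finset.sum_congr rfl fun u hu => ?_
        rw [← Finset.mul_sum, (hσ u hu s).2.2, mul_one]
      have hsx : ∑ u ∈ T, σ u s a * x u = ∑ u ∈ T, x u * σ u s a :=
        Finset.sum_congr rfl fun u _ => mul_comm _ _
      rw [mul_left_comm, ih, hsx]
      rcases (Finset.sum_nonneg hx0).eq_or_lt with h0 | hpos
      · have hx0' := (Finset.sum_eq_zero_iff_of_nonneg hx0).1 h0.symm
        rw [← h0, mul_zero, Finset.sum_eq_zero fun u hu => by rw [hx0' u hu, zero_mul]]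
      · have : G.averageStrategy P T σ s a =
            ((G.nodes s).card * ∑ u ∈ T, x u * σ u s a) / ((G.nodes s).card * ∑ u ∈ T, x u) := by
          simp only [averageStrategy]
          rw [hWs, if_pos (mul_pos hN hpos), hW]
        rw [this]
        have hpos' := hpos.ne'
        field_simp

lemma card_mul_value_deviate_averageStrategy (hG : G.PerfectRecall) {T : Finset ℕ}
    {σ : ℕ → Info → Act → ℝ} (hσ : ∀ u ∈ T, IsStrategyOn P (σ u)) (τ : Info → Act → ℝ)
    (i : Fin 2) :
    T.card * G.value (G.deviate i τ (G.averageStrategy P T σ)) i =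
      ∑ u ∈ T, G.value (G.deviate i τ (σ u)) i := by
  obtain ⟨j, hj⟩ := exists_ne i
  unfold value
  rw [Finset.mul_sum, Finset.sum_comm]
  refine Finset.sum_congr rfl fun z hz => ?_
  simp_rw [reach_deviate, G.cfReach_eq_ownReach_mul_chanceFrom _ hj.symm]
  rw [← Finset.sum_mul, ← Finset.mul_sum, ← Finset.sum_mul,
    ← G.card_mul_ownReach_averageStrategy hG hσ j (G.mem_terminals.1 hz).1]
  ring

lemma util_eq_neg {i j : Fin 2} (hij : i ≠ j) (z : List Act) : G.util i z = -G.util j z := by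
  unfold util
  have h1 : j = 0 ↔ ¬ i = 0 := by omega
  by_cases hi : i = 0 <;> simp [hi, h1]

lemma value_eq_neg (σ : Info → Act → ℝ) {i j : Fin 2} (hij : i ≠ j) :
    G.value σ i = -G.value σ j := by
  unfold value
  rw [← Finset.sum_neg_distrib]
  exact Finset.sum_congr rfl fun z _ => by rw [G.util_eq_neg hij]; ring

lemma deviate_comm (σ τ : Info → Act → ℝ) {i j : Fin 2} (hij : i ≠ j) :
    G.deviate i σ τ = G.deviate j τ σ := by
  funext s
  unfold deviate
  have h1 : G.owner s = j ↔ ¬ G.owner s = i := by omega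
  by_cases hi : G.owner s = i <;> simp [hi, h1, hij]

/-- If the best responses against the average strategy belong to the population, then small
counterfactual regrets make the average strategy an equilibrium of the full game. -/
lemma isNash_averageStrategy (hG : G.PerfectRecall) (hP0 : ∀ s, (P s).Nonempty)
    (hP : ∀ s, P s ⊆ G.acts s) {br : Fin 2 → (Info → Act → ℝ) → Info → Act}
    (hbr : G.IsBestResponseOracle br) {T : Finset ℕ} (hT : T.Nonempty)
    {σ : ℕ → Info → Act → ℝ} (hσ : ∀ u ∈ T, IsStrategyOn P (σ u))
    (hmem : ∀ s, br (G.owner s) (G.averageStrategy P T σ) s ∈ P s)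
    {Y ε : ℝ} (hY : 0 ≤ Y) (hYε : G.restrSize P * Y ≤ ε * T.card)
    (hR : ∀ i, ∀ s ∈ G.restrInfosets P i, ∀ a ∈ P s, ∑ u ∈ T, G.cfRegret (σ u) s a ≤ Y) :
    G.IsNash ε (G.averageStrategy P T σ) := by
  set avg := G.averageStrategy P T σ with havg
  have havgS : G.IsStrategy avg := (G.isStrategyOn_averageStrategy hP0 hσ).mono hP
  set b : Info → Act → ℝ := pureStrategy fun s => br (G.owner s) avg s with hb
  have hbS : IsStrategyOn P b := by
    intro s
    refine ⟨fun a => ?_, fun a ha => ?_, ?_⟩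
    · simp only [hb, pureStrategy]; split_ifs <;> norm_num
    · have : a ≠ br (G.owner s) avg s := by rintro rfl; exact ha (hmem s)
      simp [hb, pureStrategy, this]
    · simp [hb, pureStrategy]
  have hbest : ∀ i, ∀ τ, G.IsStrategy τ →
      G.value (G.deviate i τ avg) i ≤ G.value (G.deviate i b avg) i := by
    intro i τ hτ
    have h1 : G.deviate i b avg = G.deviate i (pureStrategy (br i avg)) avg := by
      funext s
      unfold deviate
      split_ifs with ho
      · subst ho; rfl
      · rfl
    rw [h1]
    exact (hbr i avg havgS).2 τ hτ
  have hTc : (0 : ℝ) < T.card := by exact_mod_cast hT.card_pos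
  have hsum : G.value (G.deviate 0 b avg) 0 + G.value (G.deviate 1 b avg) 1 ≤ ε := by
    have h1 : ∀ i, T.card * G.value (G.deviate i b avg) i ≤
        ∑ u ∈ T, G.value (σ u) i + (G.restrInfosets P i).card * Y := by
      intro i
      have := G.sum_value_deviate_sub_le hG hP hbS hσ i hY (hR i)
      rw [Finset.sum_sub_distrib, ← G.card_mul_value_deviate_averageStrategy hG hσ] at this
      linarith
    have h0 : ∑ u ∈ T, G.value (σ u) 0 = -∑ u ∈ T, G.value (σ u) 1 := by
      rw [← Finset.sum_neg_distrib]
      exact Finset.sum_congr rfl fun u _ => G.value_eq_neg _ (by decide)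
    have hX : (G.restrSize P : ℝ) =
        (G.restrInfosets P 0).card + (G.restrInfosets P 1).card := by
      unfold restrSize
      rw [Fin.sum_univ_two]; push_cast; rfl
    have h2 := h1 0
    have h3 := h1 1
    rw [hX] at hYε
    have : T.card * (G.value (G.deviate 0 b avg) 0 + G.value (G.deviate 1 b avg) 1) ≤
        T.card * ε := by linarith
    exact le_of_mul_le_mul_left this hTc
  have hself : ∀ i, G.deviate i avg avg = avg := fun i => by
    funext s; unfold deviate; split_ifs <;> rfl
  refine ⟨havgS, fun i τ hτ => ?_⟩
  obtain ⟨j, hj⟩ := exists_ne i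
  have hsum' : G.value (G.deviate i b avg) i + G.value (G.deviate j b avg) j ≤ ε := by
    fin_cases i <;> fin_cases j <;> simp_all; linarith
  have h1 := hbest i τ hτ
  have h2 := hbest j τ hτ
  have h3 := hbest i avg havgS
  have h4 := hbest j avg havgS
  rw [hself] at h3 h4
  have h5 := G.value_eq_neg avg hj
  have h6 : G.value (G.deviate i avg τ) i = -G.value (G.deviate j τ avg) j := by
    rw [G.deviate_comm _ _ hj.symm, G.value_eq_neg _ hj.symm]
  constructor <;> linarith

end EFG

namespace EFG

variable {Act Info : Type*} [Fintype Act] [Fintype Info] (G : EFG Act Info)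

/-! ### Time windows of a run -/

variable (ε : ℝ) (br : Fin 2 → (Info → Act → ℝ) → Info → Act)
  (ξ : (Info → Finset Act) → (Info → Act → ℝ) → Info → Act → ℝ) (w : ℕ → List Act)

/-- The strategy that is played in iteration `t + 1`. -/
def play (t : ℕ) : Info → Act → ℝ := current (G.run ε br ξ w t)

/-- The strategy with which the trajectory of iteration `t + 1` is sampled. -/
def sampling (t : ℕ) : Info → Act → ℝ := ξ (G.run ε br ξ w t).pop (G.play ε br ξ w t)

/-- The iterations of the window of iteration `t + 1` that precede it are those with numbers
`u + 1`, where `windowStart t ≤ u < t`. -/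
def windowStart : ℕ → ℕ
  | 0 => 0
  | t + 1 => if (G.run ε br ξ w (t + 1)).pop = (G.run ε br ξ w t).pop then windowStart t else t + 1

variable {ε br ξ w}

lemma run_succ_of_pop_eq {t : ℕ}
    (h : (G.run ε br ξ w (t + 1)).pop = (G.run ε br ξ w t).pop) :
    (G.run ε br ξ w (t + 1)).window = (G.run ε br ξ w t).window ∧
    (G.run ε br ξ w (t + 1)).regret = (G.run ε br ξ w t).regret +
      G.sampledRegret (G.sampling ε br ξ w t) (G.play ε br ξ w t) (w (t + 1)) ∧
    (G.run ε br ξ w (t + 1)).weight = G.newWeight (G.run ε br ξ w t) := by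
  simp only [run, step] at h ⊢
  split_ifs at h ⊢ with h1 h2
  · exact ⟨rfl, rfl, rfl⟩
  · exact absurd h h2
  · exact ⟨rfl, rfl, rfl⟩

lemma run_succ_of_pop_ne {t : ℕ}
    (h : (G.run ε br ξ w (t + 1)).pop ≠ (G.run ε br ξ w t).pop) :
    (G.run ε br ξ w (t + 1)).window = (G.run ε br ξ w t).window + 1 ∧
    (G.run ε br ξ w (t + 1)).regret = 0 ∧ (G.run ε br ξ w (t + 1)).weight = 0 ∧
    (G.run ε br ξ w (t + 1)).pop =
      G.expand br (G.lastWindowAverage (G.run ε br ξ w t)) (G.run ε br ξ w t).pop := by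
  simp only [run, step] at h ⊢
  split_ifs at h ⊢ with h1 h2
  · exact absurd rfl h
  · exact ⟨rfl, rfl, rfl, rfl⟩
  · exact absurd rfl h

/-- At an oracle call that does not change the population, the best responses are available. -/
lemma expand_eq_of_pop_eq {t : ℕ} (ht : (t + 1) % G.frequency ε (G.run ε br ξ w t).pop = 0)
    (h : (G.run ε br ξ w (t + 1)).pop = (G.run ε br ξ w t).pop) :
    G.expand br (G.lastWindowAverage (G.run ε br ξ w t)) (G.run ε br ξ w t).pop =
      (G.run ε br ξ w t).pop := by
  simp only [run, step] at h ⊢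
  rw [if_pos ht] at h
  split_ifs at h with h2
  · exact h2
  · exact h

lemma cost_run_succ (t : ℕ) :
    (G.run ε br ξ w (t + 1)).cost = (G.run ε br ξ w t).cost + G.visited (w (t + 1)) +
      if (t + 1) % G.frequency ε (G.run ε br ξ w t).pop = 0 then
        G.restrSize (G.run ε br ξ w t).pop else 0 := by
  simp only [run, step]
  split_ifs <;> rfl

lemma windowStart_succ_of_pop_eq {t : ℕ}
    (h : (G.run ε br ξ w (t + 1)).pop = (G.run ε br ξ w t).pop) :
    G.windowStart ε br ξ w (t + 1) = G.windowStart ε br ξ w t := by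
  simp [windowStart, h]

lemma windowStart_succ_of_pop_ne {t : ℕ}
    (h : (G.run ε br ξ w (t + 1)).pop ≠ (G.run ε br ξ w t).pop) :
    G.windowStart ε br ξ w (t + 1) = t + 1 := by
  simp [windowStart, h]

lemma windowStart_le (t : ℕ) : G.windowStart ε br ξ w t ≤ t := by
  induction t with
  | zero => simp [windowStart]
  | succ t ih =>
    by_cases h : (G.run ε br ξ w (t + 1)).pop = (G.run ε br ξ w t).pop
    · rw [G.windowStart_succ_of_pop_eq h]; omega
    · rw [G.windowStart_succ_of_pop_ne h]

lemma pop_eq_and_windowStart_eq {t u : ℕ} (hu : G.windowStart ε br ξ w t ≤ u) (hut : u ≤ t) :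
    (G.run ε br ξ w u).pop = (G.run ε br ξ w t).pop ∧
      G.windowStart ε br ξ w u = G.windowStart ε br ξ w t := by
  induction t with
  | zero => obtain rfl : u = 0 := by omega
            exact ⟨rfl, rfl⟩
  | succ t ih =>
    rcases Nat.le_succ_iff.1 hut with h' | rfl
    · by_cases h : (G.run ε br ξ w (t + 1)).pop = (G.run ε br ξ w t).pop
      · rw [G.windowStart_succ_of_pop_eq h] at hu ⊢
        rw [h]
        exact ih hu h'
      · rw [G.windowStart_succ_of_pop_ne h] at hu
        omega
    · exact ⟨rfl, rfl⟩

lemma regret_run (t : ℕ) (s : Info) (a : Act) :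
    (G.run ε br ξ w t).regret s a = ∑ u ∈ Finset.Ico (G.windowStart ε br ξ w t) t,
      G.sampledRegret (G.sampling ε br ξ w u) (G.play ε br ξ w u) (w (u + 1)) s a := by
  induction t with
  | zero => simp [run, initial]
  | succ t ih =>
    by_cases h : (G.run ε br ξ w (t + 1)).pop = (G.run ε br ξ w t).pop
    · rw [(G.run_succ_of_pop_eq h).2.1, G.windowStart_succ_of_pop_eq h,
        Finset.sum_Ico_succ_top (G.windowStart_le t), Pi.add_apply, Pi.add_apply, ih]
    · rw [(G.run_succ_of_pop_ne h).2.1, G.windowStart_succ_of_pop_ne h]; simp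

lemma weight_run (t : ℕ) (s : Info) (a : Act) :
    (G.run ε br ξ w t).weight s a = ∑ u ∈ Finset.Ico (G.windowStart ε br ξ w t) t,
      (∑ h ∈ G.nodes s, G.ownReach (G.play ε br ξ w u) (G.owner s) h) * G.play ε br ξ w u s a := by
  induction t with
  | zero => simp [run, initial]
  | succ t ih =>
    by_cases h : (G.run ε br ξ w (t + 1)).pop = (G.run ε br ξ w t).pop
    · rw [(G.run_succ_of_pop_eq h).2.2, G.windowStart_succ_of_pop_eq h,
        Finset.sum_Ico_succ_top (G.windowStart_le t), newWeight, ih]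
      rfl
    · rw [(G.run_succ_of_pop_ne h).2.2.1, G.windowStart_succ_of_pop_ne h]; simp

lemma lastWindowAverage_run (t : ℕ) :
    G.lastWindowAverage (G.run ε br ξ w t) = G.averageStrategy (G.run ε br ξ w t).pop
      (Finset.Ico (G.windowStart ε br ξ w t) (t + 1)) (G.play ε br ξ w) := by
  have : ∀ s a, G.newWeight (G.run ε br ξ w t) s a =
      ∑ u ∈ Finset.Ico (G.windowStart ε br ξ w t) (t + 1),
      (∑ h ∈ G.nodes s, G.ownReach (G.play ε br ξ w u) (G.owner s) h) *
        G.play ε br ξ w u s a := by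
    intro s a
    rw [Finset.sum_Ico_succ_top (G.windowStart_le t), newWeight, weight_run]
    rfl
  funext s a
  simp only [lastWindowAverage, averageStrategy, this]

lemma pop_run (hbr : G.IsBestResponseOracle br) (t : ℕ) :
    ∀ s, ((G.run ε br ξ w t).pop s).Nonempty ∧ (G.run ε br ξ w t).pop s ⊆ G.acts s := by
  induction t with
  | zero =>
    intro s
    have hne : ∀ s, (G.acts s).Nonempty := by
      intro s
      obtain ⟨h, hh, ⟨b, hb⟩, hs⟩ := G.exists_node s
      exact ⟨b, (G.mem_acts h hh ⟨b, hb⟩ s hs b).2 hb⟩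
    have := (hbr (G.owner s) _ (isStrategyOn_uniform hne)).1 s
    simp [run, initial, this]
  | succ t ih =>
    by_cases h : (G.run ε br ξ w (t + 1)).pop = (G.run ε br ξ w t).pop
    · rw [h]; exact ih
    · intro s
      rw [(G.run_succ_of_pop_ne h).2.2.2]
      refine ⟨Finset.insert_nonempty _ _, Finset.insert_subset ?_ (ih s).2⟩
      refine (hbr (G.owner s) _ ?_).1 s
      rw [lastWindowAverage_run]
      refine IsStrategyOn.mono (G.isStrategyOn_averageStrategy (fun s => (ih s).1) ?_)
        fun s => (ih s).2
      intro u hu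
      rw [Finset.mem_Ico] at hu
      rw [← (G.pop_eq_and_windowStart_eq hu.1 (by omega)).1]
      refine isStrategyOn_regretMatching (fun s => ?_) _
      rw [(G.pop_eq_and_windowStart_eq hu.1 (by omega)).1]
      exact (ih s).1

lemma isStrategyOn_play (hbr : G.IsBestResponseOracle br) (t : ℕ) :
    IsStrategyOn (G.run ε br ξ w t).pop (G.play ε br ξ w t) :=
  isStrategyOn_regretMatching (fun s => (G.pop_run hbr t s).1) _

lemma isStrategyOn_play_of_window (hbr : G.IsBestResponseOracle br) {t u : ℕ}
    (hu : G.windowStart ε br ξ w t ≤ u) (hut : u ≤ t) :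
    IsStrategyOn (G.run ε br ξ w t).pop (G.play ε br ξ w u) := by
  rw [← (G.pop_eq_and_windowStart_eq hu hut).1]
  exact G.isStrategyOn_play hbr u

lemma pop_run_le_succ (t : ℕ) : (G.run ε br ξ w t).pop ≤ (G.run ε br ξ w (t + 1)).pop := by
  by_cases h : (G.run ε br ξ w (t + 1)).pop = (G.run ε br ξ w t).pop
  · rw [h]
  · rw [(G.run_succ_of_pop_ne h).2.2.2]
    exact fun s => Finset.subset_insert _ _

/-- The population changes only finitely often. -/
lemma exists_windowStart_eq : ∃ t₀, ∀ t, t₀ ≤ t → (G.run ε br ξ w t).pop = (G.run ε br ξ w t₀).pop ∧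
    (G.run ε br ξ w t).window = (G.run ε br ξ w t₀).window ∧
    G.windowStart ε br ξ w t = G.windowStart ε br ξ w t₀ := by
  obtain ⟨t₀, h⟩ := WellFoundedGT.monotone_chain_condition
    (⟨fun t => (G.run ε br ξ w t).pop, monotone_nat_of_le_succ G.pop_run_le_succ⟩ :
      ℕ →o (Info → Finset Act))
  refine ⟨t₀, fun t ht => ?_⟩
  induction t, ht using Nat.le_induction with
  | base => exact ⟨rfl, rfl, rfl⟩
  | succ t ht ih =>
    have h1 : (G.run ε br ξ w (t + 1)).pop = (G.run ε br ξ w t₀).pop := (h (t + 1) (by omega)).symm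
    have h2 : (G.run ε br ξ w (t + 1)).pop = (G.run ε br ξ w t).pop := h1.trans ih.1.symm
    exact ⟨h1, (G.run_succ_of_pop_eq h2).1.trans ih.2.1,
      (G.windowStart_succ_of_pop_eq h2).trans ih.2.2⟩

/-! The state after `t` iterations is determined by the first `t` trajectories. -/

variable {w' : ℕ → List Act}

lemma run_congr {t : ℕ} (h : ∀ u ∈ Finset.Icc 1 t, w u = w' u) :
    G.run ε br ξ w t = G.run ε br ξ w' t := by
  induction t with
  | zero => rfl
  | succ t ih =>
    simp only [run]
    rw [ih fun u hu => h u (by simp at hu ⊢; omega), h (t + 1) (by simp)]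

lemma play_congr {t : ℕ} (h : ∀ u ∈ Finset.Icc 1 t, w u = w' u) :
    G.play ε br ξ w t = G.play ε br ξ w' t := by
  unfold play
  rw [G.run_congr h]

lemma sampling_congr {t : ℕ} (h : ∀ u ∈ Finset.Icc 1 t, w u = w' u) :
    G.sampling ε br ξ w t = G.sampling ε br ξ w' t := by
  unfold sampling
  rw [G.run_congr h, G.play_congr h]

lemma windowStart_congr {t : ℕ} (h : ∀ u ∈ Finset.Icc 1 t, w u = w' u) :
    G.windowStart ε br ξ w t = G.windowStart ε br ξ w' t := by
  induction t with
  | zero => rfl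
  | succ t ih =>
    have h' : ∀ u ∈ Finset.Icc 1 t, w u = w' u := fun u hu => h u (by simp at hu ⊢; omega)
    simp only [windowStart]
    rw [ih h', G.run_congr h', G.run_congr h]

lemma pop_succ_congr {t : ℕ} (h : ∀ u ∈ Finset.Icc 1 t, w u = w' u) :
    (G.run ε br ξ w (t + 1)).pop = (G.run ε br ξ w' (t + 1)).pop := by
  simp only [run, step]
  rw [G.run_congr h]
  split_ifs <;> rfl

/-! ### Regrets within a window -/

variable (ε br ξ w)

/-- The difference between the true and the sampled counterfactual regret of iteration `u + 1`. -/
def noise (u : ℕ) (s : Info) (a : Act) : ℝ :=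
  G.cfRegret (G.play ε br ξ w u) s a -
    G.sampledRegret (G.sampling ε br ξ w u) (G.play ε br ξ w u) (w (u + 1)) s a

/-- The noise accumulated in the current window. -/
def windowNoise (t : ℕ) (s : Info) (a : Act) : ℝ :=
  ∑ u ∈ Finset.Ico (G.windowStart ε br ξ w t) t, G.noise ε br ξ w u s a

variable {ε br ξ w}

lemma sum_cfRegret_eq (t : ℕ) (s : Info) (a : Act) :
    ∑ u ∈ Finset.Ico (G.windowStart ε br ξ w t) t, G.cfRegret (G.play ε br ξ w u) s a =
      (G.run ε br ξ w t).regret s a + G.windowNoise ε br ξ w t s a := by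
  rw [regret_run, windowNoise, ← Finset.sum_add_distrib]
  exact Finset.sum_congr rfl fun u _ => by unfold noise; ring

lemma isStrategyOn_sampling (hbr : G.IsBestResponseOracle br) {δ : ℝ}
    (hξ : G.IsSamplingScheme δ ξ) (t : ℕ) :
    IsStrategyOn (G.run ε br ξ w t).pop (G.sampling ε br ξ w t) :=
  (hξ _ (G.pop_run hbr t) _ (G.isStrategyOn_play hbr t)).1

lemma le_prod_ownReach_sampling (hbr : G.IsBestResponseOracle br) {δ : ℝ}
    (hξ : G.IsSamplingScheme δ ξ) (t : ℕ) : ∀ z ∈ G.terminals,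
    G.Allowed (G.run ε br ξ w t).pop z → δ ≤ ∏ i, G.ownReach (G.sampling ε br ξ w t) i z :=
  (hξ _ (G.pop_run hbr t) _ (G.isStrategyOn_play hbr t)).2

/-- The potential of regret matching grows at most linearly in the length of the window. -/
lemma sum_sq_regret_le (hG : G.PerfectRecall) {Δ δ : ℝ} (hδ : 0 < δ)
    (hΔ : ∀ z ∈ G.terminals, |G.payoff z| ≤ Δ) (hbr : G.IsBestResponseOracle br)
    (hξ : G.IsSamplingScheme δ ξ) (t : ℕ) (hw : ∀ u < t, w (u + 1) ∈ G.terminals) {s : Info}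
    (hs : s ∈ G.restrInfosets (G.run ε br ξ w t).pop (G.owner s)) :
    ∑ a ∈ (G.run ε br ξ w t).pop s, max ((G.run ε br ξ w t).regret s a) 0 ^ 2 ≤
      (t - G.windowStart ε br ξ w t : ℕ) * (((G.run ε br ξ w t).pop s).card * (Δ / δ) ^ 2) := by
  induction t with
  | zero => simp [run, initial]
  | succ t ih =>
    by_cases h : (G.run ε br ξ w (t + 1)).pop = (G.run ε br ξ w t).pop
    · rw [h] at hs ⊢
      rw [G.windowStart_succ_of_pop_eq h, (G.run_succ_of_pop_eq h).2.1]
      have h1 := ih (fun u hu => hw u (by omega)) hs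
      have h2 := sum_sq_posPart_add_le (G.sum_mul_sampledRegret (η := G.sampling ε br ξ w t)
        (G.isStrategyOn_play (ξ := ξ) (ε := ε) (w := w) hbr t) (hw t (by omega)) s)
      have h3 : ∑ a ∈ (G.run ε br ξ w t).pop s,
          G.sampledRegret (G.sampling ε br ξ w t) (G.play ε br ξ w t) (w (t + 1)) s a ^ 2 ≤
          ((G.run ε br ξ w t).pop s).card * (Δ / δ) ^ 2 := by
        rw [← nsmul_eq_mul]
        refine Finset.sum_le_card_nsmul _ _ _ fun a ha => ?_
        exact sq_le_sq' (abs_le.1 (G.abs_sampledRegret_le hG hδ hΔ (G.isStrategyOn_play hbr t)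
          (G.isStrategyOn_sampling hbr hξ t) (hw t (by omega))
          (G.le_prod_ownReach_sampling hbr hξ t _ (hw t (by omega))) hs ha)).1
          (abs_le.1 (G.abs_sampledRegret_le hG hδ hΔ (G.isStrategyOn_play hbr t)
          (G.isStrategyOn_sampling hbr hξ t) (hw t (by omega))
          (G.le_prod_ownReach_sampling hbr hξ t _ (hw t (by omega))) hs ha)).2
      have h4 : ((t + 1 - G.windowStart ε br ξ w t : ℕ) : ℝ) =
          (t - G.windowStart ε br ξ w t : ℕ) + 1 := by
        rw [Nat.succ_sub (G.windowStart_le t)]; push_cast; rfl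
      rw [h4, add_mul, one_mul]
      exact h2.trans (add_le_add h1 h3)
    · rw [(G.run_succ_of_pop_ne h).2.1, G.windowStart_succ_of_pop_ne h]; simp

lemma card_pop_le_restrActs {P : Info → Finset Act} {i : Fin 2} {s : Info}
    (hs : s ∈ G.restrInfosets P i) : (P s).card ≤ G.restrActs P :=
  (Finset.le_sup (f := fun s => (P s).card) hs).trans
    (Finset.le_sup (f := fun i => (G.restrInfosets P i).sup fun s => (P s).card)
      (Finset.mem_univ i))

lemma regret_le (hG : G.PerfectRecall) {Δ δ : ℝ} (hδ : 0 < δ) (hΔ0 : 0 ≤ Δ)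
    (hΔ : ∀ z ∈ G.terminals, |G.payoff z| ≤ Δ) (hbr : G.IsBestResponseOracle br)
    (hξ : G.IsSamplingScheme δ ξ) (t : ℕ) (hw : ∀ u < t, w (u + 1) ∈ G.terminals) {s : Info}
    (hs : s ∈ G.restrInfosets (G.run ε br ξ w t).pop (G.owner s)) {a : Act}
    (ha : a ∈ (G.run ε br ξ w t).pop s) :
    (G.run ε br ξ w t).regret s a ≤ Δ / δ * √((t - G.windowStart ε br ξ w t : ℕ) *
      G.restrActs (G.run ε br ξ w t).pop) := by
  have h1 := G.sum_sq_regret_le hG hδ hΔ hbr hξ t hw hs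
  have h2 := Finset.single_le_sum (f := fun a => max ((G.run ε br ξ w t).regret s a) 0 ^ 2)
    (fun b _ => sq_nonneg _) ha
  refine (le_max_left _ 0).trans (abs_le_of_sq_le_sq' ?_ (by positivity)).2
  rw [mul_pow, Real.sq_sqrt (by positivity)]
  refine (h2.trans h1).trans ?_
  have h3 : (((G.run ε br ξ w t).pop s).card : ℝ) ≤ G.restrActs (G.run ε br ξ w t).pop := by
    exact_mod_cast G.card_pop_le_restrActs hs
  calc _ ≤ ((t - G.windowStart ε br ξ w t : ℕ) : ℝ) *
        (G.restrActs (G.run ε br ξ w t).pop * (Δ / δ) ^ 2) := by gcongr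
    _ = _ := by ring

end EFG

/-! ### Concentration -/

/-- Hoeffding's lemma for a centred bounded variable on a finite probability space. -/
lemma sum_mul_exp_le_exp_sq {α : Type*} {Z : Finset α} {κ d : α → ℝ} {M : ℝ} (hM : 0 < M)
    (hκ0 : ∀ z ∈ Z, 0 ≤ κ z) (hκ1 : ∑ z ∈ Z, κ z = 1) (hd : ∑ z ∈ Z, κ z * d z = 0)
    (hdM : ∀ z ∈ Z, |d z| ≤ M) (l : ℝ) :
    ∑ z ∈ Z, κ z * Real.exp (l * d z) ≤ Real.exp (l ^ 2 * M ^ 2 / 2) := by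
  have hpt : ∀ z ∈ Z, Real.exp (l * d z) ≤
      Real.cosh (l * M) + d z * (Real.sinh (l * M) / M) := by
    intro z hz
    obtain ⟨h1, h2⟩ := abs_le.1 (hdM z hz)
    have hc := convexOn_exp.2 (Set.mem_univ (l * M)) (Set.mem_univ (-(l * M)))
      (show 0 ≤ (1 + d z / M) / 2 by
        have : -1 ≤ d z / M := by rw [le_div_iff₀ hM]; linarith
        linarith)
      (show 0 ≤ (1 - d z / M) / 2 by
        have : d z / M ≤ 1 := by rw [div_le_iff₀ hM]; linarith
        linarith)
      (by ring)
    have he : ((1 + d z / M) / 2) • (l * M) + ((1 - d z / M) / 2) • (-(l * M)) = l * d z := by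
      simp only [smul_eq_mul]; field_simp; ring
    rw [he] at hc
    refine hc.trans_eq ?_
    rw [Real.cosh_eq, Real.sinh_eq]
    simp only [smul_eq_mul]
    field_simp; ring
  calc ∑ z ∈ Z, κ z * Real.exp (l * d z)
      ≤ ∑ z ∈ Z, κ z * (Real.cosh (l * M) + d z * (Real.sinh (l * M) / M)) :=
        Finset.sum_le_sum fun z hz => mul_le_mul_of_nonneg_left (hpt z hz) (hκ0 z hz)
    _ = (∑ z ∈ Z, κ z) * Real.cosh (l * M) +
        (∑ z ∈ Z, κ z * d z) * (Real.sinh (l * M) / M) := by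
        rw [Finset.sum_mul, Finset.sum_mul, ← Finset.sum_add_distrib]
        exact Finset.sum_congr rfl fun z _ => by ring
    _ = Real.cosh (l * M) := by rw [hκ1, hd]; ring
    _ ≤ Real.exp ((l * M) ^ 2 / 2) := Real.cosh_le_exp_half_sq _
    _ = _ := by rw [mul_pow]

open MeasureTheory in
/-- Ville's inequality for a process whose next step is drawn from a finite set with probabilities
that depend on the past: a nonnegative supermartingale that starts at `c` reaches `1` with
probability at most `c`. Steps of conditional probability zero do not occur either. -/
lemma measure_exists_one_le_le {α Ω : Type*} [MeasurableSpace Ω] {μ : Measure Ω}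
    [IsProbabilityMeasure μ] {ζ : ℕ → Ω → α} {Z : Finset α} {κ : ℕ → (ℕ → α) → α → ℝ}
    {Φ : ℕ → (ℕ → α) → ℝ}
    (hmeas : ∀ t z, MeasurableSet {ω | ζ t ω = z})
    (hlaw : ∀ (t : ℕ) (w : ℕ → α), w (t + 1) ∈ Z →
      μ {ω | ∀ s ∈ Finset.Icc 1 (t + 1), ζ s ω = w s} =
        μ {ω | ∀ s ∈ Finset.Icc 1 t, ζ s ω = w s} * ENNReal.ofReal (κ t w (w (t + 1))))
    (hκ0 : ∀ t w, ∀ z ∈ Z, 0 ≤ κ t w z) (hκ1 : ∀ t w, ∑ z ∈ Z, κ t w z = 1)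
    (hκc : ∀ t w w', (∀ u ∈ Finset.Icc 1 t, w u = w' u) → κ t w = κ t w')
    (hΦc : ∀ t w w', (∀ u ∈ Finset.Icc 1 t, w u = w' u) → Φ t w = Φ t w')
    (hΦ0 : ∀ t w, 0 ≤ Φ t w)
    (hΦ : ∀ t w, ∑ z ∈ Z, κ t w z * Φ (t + 1) (Function.update w (t + 1) z) ≤ Φ t w)
    (w₀ : ℕ → α) :
    μ {ω | ∃ t, 1 ≤ Φ t (fun u => ζ u ω) ∨ ζ (t + 1) ω ∉ Z ∨
      κ t (fun u => ζ u ω) (ζ (t + 1) ω) = 0} ≤ ENNReal.ofReal (Φ 0 w₀) := by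
  set A : ℕ → (ℕ → α) → Set Ω := fun t w => {ω | ∀ s ∈ Finset.Icc 1 t, ζ s ω = w s} with hA
  have hAm : ∀ t w, MeasurableSet (A t w) := by
    intro t w
    have : A t w = ⋂ s ∈ Finset.Icc 1 t, {ω | ζ s ω = w s} := by ext; simp [hA]
    rw [this]
    exact Finset.measurableSet_biInter _ fun s _ => hmeas s _
  have hAsucc : ∀ t w z, A (t + 1) (Function.update w (t + 1) z) =
      A t w ∩ {ω | ζ (t + 1) ω = z} := by
    intro t w z
    ext ω
    simp only [hA, Set.mem_ofPred_eq, Set.mem_inter_iff, Finset.mem_Icc]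
    constructor
    · intro h
      refine ⟨fun s hs => ?_, by simpa using h (t + 1) ⟨by omega, le_rfl⟩⟩
      rw [h s ⟨hs.1, by omega⟩, Function.update_of_ne (by omega)]
    · rintro ⟨h1, h2⟩ s hs
      rcases eq_or_ne s (t + 1) with rfl | hne
      · simpa using h2
      · rw [Function.update_of_ne hne]
        exact h1 s ⟨hs.1, by omega⟩
  have hμsucc : ∀ t w, ∀ z ∈ Z, μ (A (t + 1) (Function.update w (t + 1) z)) =
      μ (A t w) * ENNReal.ofReal (κ t w z) := by
    intro t w z hz
    have h1 : ∀ u ∈ Finset.Icc 1 t, Function.update w (t + 1) z u = w u := fun u hu => by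
      rw [Finset.mem_Icc] at hu
      exact Function.update_of_ne (by omega) _ _
    have h := hlaw t (Function.update w (t + 1) z) (by simpa using hz)
    rw [Function.update_self, hκc _ _ _ h1] at h
    refine h.trans ?_
    congr 2
    ext ω
    exact forall₂_congr fun u hu => by rw [h1 u hu]
  -- almost surely the next step lies in `Z`
  have hnull : ∀ t w, μ (A t w \ ⋃ z ∈ Z, A (t + 1) (Function.update w (t + 1) z)) = 0 := by
    intro t w
    have hsub : (⋃ z ∈ Z, A (t + 1) (Function.update w (t + 1) z)) ⊆ A t w :=
      Set.iUnion₂_subset fun z _ => by rw [hAsucc]; exact Set.inter_subset_left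
    rw [measure_sdiff hsub (Finset.measurableSet_biUnion _ fun z _ => hAm _ _).nullMeasurableSet
      (measure_ne_top _ _), measure_biUnion_finset _ fun z _ => hAm _ _,
      Finset.sum_congr rfl (hμsucc t w), ← Finset.mul_sum,
      ← ENNReal.ofReal_sum_of_nonneg (hκ0 t w), hκ1]
    · simp
    · intro z _ z' _ hne
      rw [Function.onFun, hAsucc, hAsucc]
      refine Set.disjoint_left.2 fun ω h h' => hne (h.2.symm.trans h'.2)
  set E : ℕ → ℕ → Set Ω := fun t n => {ω | ∃ u, t ≤ u ∧ u ≤ t + n ∧ (1 ≤ Φ u (fun u => ζ u ω) ∨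
    (u < t + n ∧ (ζ (u + 1) ω ∉ Z ∨ κ u (fun u => ζ u ω) (ζ (u + 1) ω) = 0)))} with hE
  have key : ∀ n t w, μ (A t w ∩ E t n) ≤ ENNReal.ofReal (Φ t w) * μ (A t w) := by
    intro n
    induction n with
    | zero =>
      intro t w
      by_cases hlt : 1 ≤ Φ t w
      · calc μ (A t w ∩ E t 0) ≤ μ (A t w) := measure_mono Set.inter_subset_left
          _ ≤ _ := le_mul_of_one_le_left' (by simpa using hlt)
      · have : A t w ∩ E t 0 = ∅ := by
          refine Set.eq_empty_of_forall_notMem fun ω hω => ?_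
          obtain ⟨h1, u, h2, h3, h4 | ⟨h4, _⟩⟩ := hω
          · obtain rfl : u = t := by omega
            rw [hΦc u _ w h1] at h4
            exact hlt h4
          · omega
        rw [this]; simp
    | succ n ih =>
      intro t w
      by_cases hlt : 1 ≤ Φ t w
      · calc μ (A t w ∩ E t (n + 1)) ≤ μ (A t w) := measure_mono Set.inter_subset_left
          _ ≤ _ := le_mul_of_one_le_left' (by simpa using hlt)
      have hstep : ∀ z ∈ Z, μ (A (t + 1) (Function.update w (t + 1) z) ∩ E t (n + 1)) ≤
          ENNReal.ofReal (κ t w z * Φ (t + 1) (Function.update w (t + 1) z)) * μ (A t w) := by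
        intro z hz
        rcases (hκ0 t w z hz).eq_or_lt with h0 | hpos
        · refine (measure_mono Set.inter_subset_left).trans ?_
          rw [hμsucc t w z hz, ← h0]; simp
        · have hsub : A (t + 1) (Function.update w (t + 1) z) ∩ E t (n + 1) ⊆
              A (t + 1) (Function.update w (t + 1) z) ∩ E (t + 1) n := by
            rintro ω ⟨h1, u, h2, h3, h4⟩
            refine ⟨h1, ?_⟩
            rw [hAsucc] at h1
            obtain ⟨h1, h5⟩ := h1
            change ζ (t + 1) ω = z at h5
            rcases h2.eq_or_lt with rfl | h2
            · exfalso
              rw [hΦc _ _ w h1, hκc _ _ w h1, h5] at h4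
              rcases h4 with h4 | ⟨_, h4 | h4⟩
              · exact hlt h4
              · exact h4 hz
              · exact hpos.ne' h4
            · exact ⟨u, h2, by omega, h4.imp_right fun h => ⟨by omega, h.2⟩⟩
          refine (measure_mono hsub).trans ((ih _ _).trans_eq ?_)
          rw [hμsucc t w z hz, ENNReal.ofReal_mul hpos.le]
          ring
      have hcover : A t w ∩ E t (n + 1) ⊆
          (A t w \ ⋃ z ∈ Z, A (t + 1) (Function.update w (t + 1) z)) ∪
            ⋃ z ∈ Z, (A (t + 1) (Function.update w (t + 1) z) ∩ E t (n + 1)) := by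
        rintro ω ⟨h1, h2⟩
        by_cases h3 : ω ∈ ⋃ z ∈ Z, A (t + 1) (Function.update w (t + 1) z)
        · obtain ⟨z, hz, h3⟩ := Set.mem_iUnion₂.1 h3
          exact Or.inr (Set.mem_iUnion₂.2 ⟨z, hz, h3, h2⟩)
        · exact Or.inl ⟨h1, h3⟩
      calc μ (A t w ∩ E t (n + 1))
          ≤ 0 + ∑ z ∈ Z, μ (A (t + 1) (Function.update w (t + 1) z) ∩ E t (n + 1)) :=
            (measure_mono hcover).trans ((measure_union_le _ _).trans
              (add_le_add (hnull t w).le (measure_biUnion_finset_le _ _)))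
        _ ≤ ∑ z ∈ Z, ENNReal.ofReal (κ t w z * Φ (t + 1) (Function.update w (t + 1) z)) *
              μ (A t w) := by
            rw [zero_add]; exact Finset.sum_le_sum hstep
        _ = ENNReal.ofReal (∑ z ∈ Z, κ t w z * Φ (t + 1) (Function.update w (t + 1) z)) *
              μ (A t w) := by
            rw [← Finset.sum_mul, ENNReal.ofReal_sum_of_nonneg]
            exact fun z hz => mul_nonneg (hκ0 t w z hz) (hΦ0 _ _)
        _ ≤ _ := by gcongr; exact hΦ t w
  have hunion : {ω | ∃ t, 1 ≤ Φ t (fun u => ζ u ω) ∨ ζ (t + 1) ω ∉ Z ∨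
      κ t (fun u => ζ u ω) (ζ (t + 1) ω) = 0} ⊆ ⋃ n, E 0 n := by
    rintro ω ⟨t, h⟩
    exact Set.mem_iUnion.2 ⟨t + 1, t, by omega, by omega, h.imp_right fun h => ⟨by omega, h⟩⟩
  have hmono : Monotone (E 0) := by
    rintro n m hnm ω ⟨u, h1, h2, h3⟩
    exact ⟨u, h1, by omega, h3.imp_right fun h => ⟨by omega, h.2⟩⟩
  refine (measure_mono hunion).trans ?_
  rw [hmono.measure_iUnion]
  refine iSup_le fun n => ?_
  have huniv : A 0 w₀ = Set.univ := by ext; simp [hA]; omega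
  have := key n 0 w₀
  rwa [huniv, Set.univ_inter, measure_univ, mul_one] at this

namespace EFG

variable {Act Info : Type*} [Fintype Act] [Fintype Info] (G : EFG Act Info)

/-- The failure probability that is granted to each pair of an information set and an action in
the window with index `j`: the windows share `p` in the proportions `1 / ((j + 1) (j + 2))`. -/
def failureShare (p : ℝ) (j : ℕ) (P : Info → Finset Act) : ℝ :=
  p / ((j + 1) * (j + 2) * (G.restrSize P * G.restrActs P))

/-- The rate `l` in the exponential supermartingale `exp (l S - n l² M² / 2)` of a window, `M` being
the bound on the noise. It makes the drift `l M² / 2` of a single information set equal to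
`ε / (2 X)`, so that the `X` of them together use up half of the accuracy `ε`. -/
def tilt (ε M : ℝ) (P : Info → Finset Act) : ℝ := ε / (G.restrSize P * M ^ 2)

/-- The sum over the information sets of the restricted game and their actions of the exponential
supermartingales of the noise in the current window, plus the failure probability reserved for
later windows. -/
def failurePotential (ε : ℝ) (br : Fin 2 → (Info → Act → ℝ) → Info → Act)
    (ξ : (Info → Finset Act) → (Info → Act → ℝ) → Info → Act → ℝ) (p M : ℝ)
    (t : ℕ) (w : ℕ → List Act) : ℝ :=
  let P := (G.run ε br ξ w t).pop
  let j := (G.run ε br ξ w t).window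
  p / (j + 2) + G.failureShare p j P *
    ∑ i, ∑ s ∈ G.restrInfosets P i, ∑ a ∈ P s,
      Real.exp (G.tilt ε M P * G.windowNoise ε br ξ w t s a -
        (t - G.windowStart ε br ξ w t : ℕ) * (G.tilt ε M P ^ 2 * M ^ 2 / 2))

variable {ε : ℝ} {br : Fin 2 → (Info → Act → ℝ) → Info → Act}
  {ξ : (Info → Finset Act) → (Info → Act → ℝ) → Info → Act → ℝ} {w : ℕ → List Act} {p M : ℝ}

lemma failureShare_nonneg (hp : 0 ≤ p) (j : ℕ) (P : Info → Finset Act) :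
    0 ≤ G.failureShare p j P := by
  unfold failureShare; positivity

lemma failurePotential_nonneg (hp : 0 ≤ p) (t : ℕ) (w : ℕ → List Act) :
    0 ≤ G.failurePotential ε br ξ p M t w := by
  unfold failurePotential
  have := G.failureShare_nonneg hp (G.run ε br ξ w t).window (G.run ε br ξ w t).pop
  positivity

lemma failureShare_mul_sum_le (hp : 0 ≤ p) (j : ℕ) (P : Info → Finset Act) :
    p / (j + 2) + G.failureShare p j P *
      ∑ i, ∑ s ∈ G.restrInfosets P i, ∑ _a ∈ P s, (1 : ℝ) ≤ p / (j + 1) := by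
  have h1 : ∑ i, ∑ s ∈ G.restrInfosets P i, ∑ _a ∈ P s, (1 : ℝ) ≤
      G.restrSize P * G.restrActs P := by
    unfold restrSize
    push_cast
    rw [Finset.sum_mul]
    refine Finset.sum_le_sum fun i _ => ?_
    rw [← nsmul_eq_mul]
    refine Finset.sum_le_card_nsmul _ _ _ fun s hs => ?_
    simpa using G.card_pop_le_restrActs hs
  have h2 : G.failureShare p j P * ∑ i, ∑ s ∈ G.restrInfosets P i, ∑ _a ∈ P s, (1 : ℝ) ≤
      p / ((j + 1) * (j + 2)) := by
    refine (mul_le_mul_of_nonneg_left h1 (G.failureShare_nonneg hp j P)).trans ?_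
    unfold failureShare
    rcases eq_or_ne ((G.restrSize P : ℝ) * G.restrActs P) 0 with h0 | hne
    · rw [h0]; simp; positivity
    · rw [← div_div, div_mul_cancel₀ _ hne]
  have h3 : p / ((j : ℝ) + 2) + p / ((j + 1) * (j + 2)) = p / (j + 1) := by
    field_simp; ring
  linarith

lemma windowNoise_congr {w' : ℕ → List Act} {t : ℕ} (h : ∀ u ∈ Finset.Icc 1 t, w u = w' u) :
    G.windowNoise ε br ξ w t = G.windowNoise ε br ξ w' t := by
  funext s a
  unfold windowNoise noise
  rw [G.windowStart_congr h]
  refine Finset.sum_congr rfl fun u hu => ?_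
  have hu' := (Finset.mem_Ico.1 hu).2
  have h' : ∀ v ∈ Finset.Icc 1 u, w v = w' v := fun v hv => h v (by simp at hv ⊢; omega)
  rw [G.play_congr h', G.sampling_congr h', h (u + 1) (by simp; omega)]

lemma failurePotential_congr {w' : ℕ → List Act} {t : ℕ}
    (h : ∀ u ∈ Finset.Icc 1 t, w u = w' u) :
    G.failurePotential ε br ξ p M t w = G.failurePotential ε br ξ p M t w' := by
  simp only [failurePotential]
  rw [G.run_congr h, G.windowStart_congr h, G.windowNoise_congr h]

lemma failurePotential_zero_le (hp : 0 ≤ p) (w : ℕ → List Act) :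
    G.failurePotential ε br ξ p M 0 w ≤ p := by
  have h := G.failureShare_mul_sum_le hp 0 (G.initial br).pop
  simp only [failurePotential, run, windowStart, windowNoise]
  simpa [initial] using h

lemma noise_update (t : ℕ) (z : List Act) (s : Info) (a : Act) :
    G.noise ε br ξ (Function.update w (t + 1) z) t s a = G.cfRegret (G.play ε br ξ w t) s a -
      G.sampledRegret (G.sampling ε br ξ w t) (G.play ε br ξ w t) z s a := by
  have h : ∀ u ∈ Finset.Icc 1 t, Function.update w (t + 1) z u = w u := fun u hu => by
    rw [Finset.mem_Icc] at hu
    exact Function.update_of_ne (by omega) _ _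
  unfold noise
  rw [G.play_congr h, G.sampling_congr h, Function.update_self]

/-- The failure potential is a supermartingale. Within a window this is Hoeffding's lemma; when a
window ends, the reserve pays for the new one. -/
lemma sum_reach_mul_failurePotential_le (hG : G.PerfectRecall) {Δ δ : ℝ} (hΔ0 : 0 < Δ)
    (hδ : 0 < δ) (hΔ : ∀ z ∈ G.terminals, |G.payoff z| ≤ Δ) (hbr : G.IsBestResponseOracle br)
    (hξ : G.IsSamplingScheme δ ξ) (hp : 0 ≤ p) (t : ℕ) (w : ℕ → List Act) :
    ∑ z ∈ G.terminals, G.reach (G.sampling ε br ξ w t) z *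
      G.failurePotential ε br ξ p (2 * (Δ / δ)) (t + 1) (Function.update w (t + 1) z) ≤
    G.failurePotential ε br ξ p (2 * (Δ / δ)) t w := by
  set M : ℝ := 2 * (Δ / δ) with hMdef
  have hM : 0 < M := by positivity
  set η := G.sampling ε br ξ w t with hη
  have hηS := G.isStrategyOn_sampling (ε := ε) (w := w) hbr hξ t
  have hpop := G.pop_run (ε := ε) (ξ := ξ) (w := w) hbr t
  have hκ0 : ∀ z ∈ G.terminals, 0 ≤ G.reach η z :=
    fun z _ => G.reachFrom_nonneg (fun s => (hηS s).1) _ _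
  have hκ1 : ∑ z ∈ G.terminals, G.reach η z = 1 :=
    G.sum_reach_terminals (hηS.mono fun s => (hpop s).2)
  have hc : ∀ z, ∀ u ∈ Finset.Icc 1 t, Function.update w (t + 1) z u = w u := fun z u hu => by
    rw [Finset.mem_Icc] at hu
    exact Function.update_of_ne (by omega) _ _
  have hpz : ∀ z, (G.run ε br ξ (Function.update w (t + 1) z) (t + 1)).pop =
      (G.run ε br ξ w (t + 1)).pop := fun z => G.pop_succ_congr (hc z)
  by_cases hsame : (G.run ε br ξ w (t + 1)).pop = (G.run ε br ξ w t).pop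
  · have hz' : ∀ z, (G.run ε br ξ (Function.update w (t + 1) z) (t + 1)).pop =
        (G.run ε br ξ (Function.update w (t + 1) z) t).pop := fun z => by
      rw [hpz, hsame, G.run_congr (hc z)]
    set P := (G.run ε br ξ w t).pop with hP
    set j := (G.run ε br ξ w t).window with hj
    set l := G.tilt ε M P with hl
    set n : ℕ := t - G.windowStart ε br ξ w t with hn
    have hval : ∀ z, G.failurePotential ε br ξ p M (t + 1) (Function.update w (t + 1) z) =
        p / (j + 2) + G.failureShare p j P * ∑ i, ∑ s ∈ G.restrInfosets P i, ∑ a ∈ P s,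
          Real.exp (l * G.windowNoise ε br ξ w t s a - n * (l ^ 2 * M ^ 2 / 2)) *
            (Real.exp (l * (G.cfRegret (G.play ε br ξ w t) s a -
              G.sampledRegret η (G.play ε br ξ w t) z s a)) *
                Real.exp (-(l ^ 2 * M ^ 2 / 2))) := by
      intro z
      have hwin : ∀ s a, G.windowNoise ε br ξ (Function.update w (t + 1) z) (t + 1) s a =
          G.windowNoise ε br ξ w t s a + (G.cfRegret (G.play ε br ξ w t) s a -
              G.sampledRegret η (G.play ε br ξ w t) z s a) := by
        intro s a
        rw [← G.windowNoise_congr (hc z), ← G.noise_update]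
        unfold windowNoise
        rw [G.windowStart_succ_of_pop_eq (hz' z),
          Finset.sum_Ico_succ_top (G.windowStart_le t)]
      have hn1 : ((t + 1 - G.windowStart ε br ξ w t : ℕ) : ℝ) = n + 1 := by
        rw [Nat.succ_sub (G.windowStart_le t)]; push_cast; rfl
      simp only [failurePotential]
      rw [(G.run_succ_of_pop_eq (hz' z)).1, hz', G.windowStart_succ_of_pop_eq (hz' z),
        G.run_congr (hc z), G.windowStart_congr (hc z), hn1]
      simp_rw [hwin, ← Real.exp_add]
      rw [← hP, ← hj, ← hl]
      congr 2
      refine Finset.sum_congr rfl fun i _ => Finset.sum_congr rfl fun s _ =>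
        Finset.sum_congr rfl fun a _ => ?_
      congr 1
      ring
    have hmgf : ∀ i, ∀ s ∈ G.restrInfosets P i, ∀ a ∈ P s,
        ∑ z ∈ G.terminals, G.reach η z * Real.exp (l * (G.cfRegret (G.play ε br ξ w t) s a -
              G.sampledRegret η (G.play ε br ξ w t) z s a)) ≤ Real.exp (l ^ 2 * M ^ 2 / 2) := by
      intro i s hs a ha
      obtain rfl := (G.mem_restrInfosets.1 hs).1
      refine sum_mul_exp_le_exp_sq hM hκ0 hκ1 ?_ (fun z hz => ?_) l
      · simp_rw [mul_sub, Finset.sum_sub_distrib]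
        rw [← Finset.sum_mul, hκ1, one_mul, G.sum_reach_mul_sampledRegret hG hδ
          (G.isStrategyOn_play hbr t) hηS (G.le_prod_ownReach_sampling hbr hξ t) hs ha, sub_self]
      · have h1 := abs_le.1 (G.abs_cfRegret_le hG hδ hΔ (fun s => (hpop s).2)
          (G.isStrategyOn_play hbr t) hηS (G.le_prod_ownReach_sampling hbr hξ t) hs ha)
        have h2 := abs_le.1 (G.abs_sampledRegret_le hG hδ hΔ (G.isStrategyOn_play hbr t) hηS hz
          (G.le_prod_ownReach_sampling hbr hξ t z hz) hs ha)
        rw [abs_le]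
        constructor <;> linarith
    simp_rw [hval, mul_add, Finset.sum_add_distrib, ← Finset.sum_mul]
    rw [hκ1, one_mul]
    simp only [failurePotential]
    refine add_le_add le_rfl ?_
    simp_rw [mul_left_comm _ (G.failureShare p j P), ← Finset.mul_sum]
    refine mul_le_mul_of_nonneg_left ?_ (G.failureShare_nonneg hp j P)
    simp_rw [Finset.mul_sum]
    rw [Finset.sum_comm]
    refine Finset.sum_le_sum fun i _ => ?_
    rw [Finset.sum_comm]
    refine Finset.sum_le_sum fun s hs => ?_
    rw [Finset.sum_comm]
    refine Finset.sum_le_sum fun a ha => ?_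
    calc _ = Real.exp (l * G.windowNoise ε br ξ w t s a - n * (l ^ 2 * M ^ 2 / 2)) *
          (∑ z ∈ G.terminals, G.reach η z * Real.exp (l * (G.cfRegret (G.play ε br ξ w t) s a -
              G.sampledRegret η (G.play ε br ξ w t) z s a))) *
            Real.exp (-(l ^ 2 * M ^ 2 / 2)) := by
          rw [Finset.mul_sum, Finset.sum_mul]
          exact Finset.sum_congr rfl fun z _ => by ring
      _ ≤ Real.exp (l * G.windowNoise ε br ξ w t s a - n * (l ^ 2 * M ^ 2 / 2)) *
          Real.exp (l ^ 2 * M ^ 2 / 2) * Real.exp (-(l ^ 2 * M ^ 2 / 2)) := by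
          gcongr
          exact hmgf i s hs a ha
      _ = _ := by rw [mul_assoc, ← Real.exp_add, add_neg_cancel, Real.exp_zero, mul_one]
  · have hz' : ∀ z, (G.run ε br ξ (Function.update w (t + 1) z) (t + 1)).pop ≠
        (G.run ε br ξ (Function.update w (t + 1) z) t).pop := fun z => by
      rw [hpz, G.run_congr (hc z)]; exact hsame
    have hval : ∀ z, G.failurePotential ε br ξ p M (t + 1) (Function.update w (t + 1) z) ≤
        p / ((G.run ε br ξ w t).window + 2) := by
      intro z
      have h := G.failureShare_mul_sum_le hp ((G.run ε br ξ w t).window + 1)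
        (G.run ε br ξ w (t + 1)).pop
      simp only [failurePotential, windowNoise]
      rw [(G.run_succ_of_pop_ne (hz' z)).1, G.windowStart_succ_of_pop_ne (hz' z), hpz,
        G.run_congr (hc z)]
      have h2 : (((G.run ε br ξ w t).window + 1 : ℕ) : ℝ) + 1 =
          (G.run ε br ξ w t).window + 2 := by push_cast; ring
      rw [h2] at h
      simpa using h
    calc _ ≤ ∑ z ∈ G.terminals, G.reach η z * (p / ((G.run ε br ξ w t).window + 2)) :=
          Finset.sum_le_sum fun z hz => mul_le_mul_of_nonneg_left (hval z) (hκ0 z hz)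
      _ = p / ((G.run ε br ξ w t).window + 2) := by rw [← Finset.sum_mul, hκ1, one_mul]
      _ ≤ _ := by
          simp only [failurePotential]
          refine le_add_of_nonneg_right (mul_nonneg (G.failureShare_nonneg hp _ _) ?_)
          positivity

open MeasureTheory in
/-- With probability at least `1 - p` the failure potential stays below `1` and only trajectories
of positive probability are sampled. -/
lemma measure_failurePotential_lt_one_ge (hG : G.PerfectRecall) {Δ δ : ℝ} (hΔ0 : 0 < Δ)
    (hδ : 0 < δ) (hΔ : ∀ z ∈ G.terminals, |G.payoff z| ≤ Δ) (hbr : G.IsBestResponseOracle br)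
    (hξ : G.IsSamplingScheme δ ξ) (hp : 0 ≤ p) {Ω : Type*} [MeasurableSpace Ω] {μ : Measure Ω}
    [IsProbabilityMeasure μ] {ζ : ℕ → Ω → List Act} (hζ : G.IsExecution ε br ξ μ ζ) :
    ENNReal.ofReal (1 - p) ≤ μ {ω | ∀ t,
      G.failurePotential ε br ξ p (2 * (Δ / δ)) t (fun u => ζ u ω) < 1 ∧
      ζ (t + 1) ω ∈ G.terminals ∧
      G.reach (G.sampling ε br ξ (fun u => ζ u ω) t) (ζ (t + 1) ω) ≠ 0} := by
  have hv := measure_exists_one_le_le (μ := μ) (ζ := ζ) (Z := G.terminals)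
    (κ := fun t w => G.reach (G.sampling ε br ξ w t))
    (Φ := G.failurePotential ε br ξ p (2 * (Δ / δ))) hζ.measurable hζ.law
    (fun t w z _ => G.reachFrom_nonneg (fun s => (G.isStrategyOn_sampling hbr hξ t s).1) _ _)
    (fun t w => G.sum_reach_terminals
      ((G.isStrategyOn_sampling hbr hξ t).mono fun s => (G.pop_run hbr t s).2))
    (fun t w w' h => by rw [G.sampling_congr h])
    (fun t w w' h => G.failurePotential_congr h)
    (G.failurePotential_nonneg hp)
    (G.sum_reach_mul_failurePotential_le hG hΔ0 hδ hΔ hbr hξ hp) (fun _ => [])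
  have hv' := hv.trans (ENNReal.ofReal_le_ofReal (G.failurePotential_zero_le hp _))
  rw [ENNReal.ofReal_sub _ hp, ENNReal.ofReal_one, tsub_le_iff_right, ← measure_univ (μ := μ)]
  refine le_trans (measure_mono fun ω _ => ?_) ((measure_union_le _ _).trans
    (add_le_add le_rfl hv'))
  by_cases h : ∃ t, 1 ≤ G.failurePotential ε br ξ p (2 * (Δ / δ)) t (fun u => ζ u ω) ∨
      ζ (t + 1) ω ∉ G.terminals ∨
      G.reach (G.sampling ε br ξ (fun u => ζ u ω) t) (ζ (t + 1) ω) = 0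
  · exact Or.inr h
  · push Not at h
    exact Or.inl h

end EFG

/-! ### Arithmetic of a window -/

/-- The cost of a window of at most `T + m` further iterations: `r` is the adaptive frequency before
rounding, for which the iterations and the oracle calls are balanced. -/
lemma window_cost_le {Δ B ε X A A' H H' L c ℓ T m : ℝ} (hε : 0 < ε) (hεΔ : ε ≤ 2 * Δ)
    (hX : 1 ≤ X) (hA' : 1 ≤ A') (hH' : 1 ≤ H') (hA : A' ≤ A) (hH : H' ≤ H)
    (hL : L ≤ c * ℓ) (hc : 0 ≤ c) (hℓ : 1 ≤ 2 * ℓ)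
    (hT : T ≤ 16 * B ^ 2 * X ^ 2 * (A' + L) / ε ^ 2 + 1) (hm1 : 1 ≤ m)
    (hm : √(A' * X ^ 3 / (H' * ε ^ 2)) ≤ m) (hm' : m ≤ √(A' * X ^ 3 / (H' * ε ^ 2)) + 1) :
    (T + m + 1) * (2 * H') + ((T + m) / m + 2) * X ≤
      (32 * B ^ 2 + 24 * Δ ^ 2 + 8 * Δ + 2) * (2 + c) * ℓ *
        (A * H * X ^ 2 / ε ^ 2 + 2 * (√(A * H) * X ^ (1.5 : ℝ) / ε)) := by
  have hΔ : 0 < Δ := by linarith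
  have hX0 : 0 < X := by linarith
  have hA0 : 0 < A := by linarith
  have hH0 : 0 < H := by linarith
  have hA'0 : 0 < A' := by linarith
  have hH'0 : 0 < H' := by linarith
  set r := √(A' * X ^ 3 / (H' * ε ^ 2)) with hr
  set W := A * H * X ^ 2 / ε ^ 2 with hW
  set V := √(A * H) * X ^ (1.5 : ℝ) / ε with hV
  have hr0 : 0 < r := Real.sqrt_pos.2 (by positivity)
  have hW0 : 0 < W := by positivity
  have hV0 : 0 < V := by positivity
  have hr2 : r ^ 2 = A' * X ^ 3 / (H' * ε ^ 2) := Real.sq_sqrt (by positivity)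
  have hX3 : (X ^ (1.5 : ℝ)) ^ 2 = X ^ 3 := by
    rw [← Real.rpow_natCast, ← Real.rpow_mul hX0.le, ← Real.rpow_natCast X 3]; norm_num
  have hV2 : V ^ 2 = A * H * X ^ 3 / ε ^ 2 := by
    rw [hV, div_pow, mul_pow, hX3, Real.sq_sqrt (by positivity)]
  have hAH : A' * H' ≤ A * H := by gcongr
  have hrH : r * H' ≤ V := by
    refine le_of_sq_le_sq ?_ hV0.le
    rw [mul_pow, hr2, hV2]
    calc A' * X ^ 3 / (H' * ε ^ 2) * H' ^ 2 = A' * H' * X ^ 3 / ε ^ 2 := by field_simp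
      _ ≤ _ := by gcongr
  have hXV : X ≤ 2 * Δ * V := by
    have h1 : X / ε ≤ V := by
      refine le_of_sq_le_sq ?_ hV0.le
      rw [div_pow, hV2]
      have : 1 * 1 * X ^ 2 ≤ A * H * X ^ 3 := by
        gcongr
        · linarith
        · linarith
        · norm_num
      gcongr
      linarith
    rw [div_le_iff₀ hε] at h1
    calc X ≤ V * ε := h1
      _ ≤ V * (2 * Δ) := by gcongr
      _ = _ := by ring
  have hHW : H' ≤ 4 * Δ ^ 2 * W := by
    have h1 : H' / ε ^ 2 ≤ W := by
      have : 1 * H' * 1 ≤ A * H * X ^ 2 := by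
        gcongr
        · linarith
        · nlinarith
      rw [hW]
      gcongr
      linarith
    rw [div_le_iff₀ (by positivity)] at h1
    calc H' ≤ W * ε ^ 2 := h1
      _ ≤ W * (2 * Δ) ^ 2 := by gcongr
      _ = _ := by ring
  have hcℓ : 0 ≤ c * ℓ := mul_nonneg hc (by linarith)
  have hAL : A' + L ≤ A' * (1 + c * ℓ) := by nlinarith
  set R := 16 * B ^ 2 * X ^ 2 * (A' * (1 + c * ℓ)) / ε ^ 2 with hR
  have hR0 : 0 ≤ R := by positivity
  have hTR : T ≤ R + 1 := hT.trans (by rw [hR]; gcongr)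
  have hRH : R * H' ≤ 16 * B ^ 2 * (1 + c * ℓ) * W := by
    calc R * H' = 16 * B ^ 2 * (1 + c * ℓ) * (A' * H' * X ^ 2 / ε ^ 2) := by rw [hR]; ring
      _ ≤ _ := by rw [hW]; gcongr
  have hRX : R * X / r ≤ 16 * B ^ 2 * (1 + c * ℓ) * V := by
    have h1 : R * X = 16 * B ^ 2 * (1 + c * ℓ) * (r * H') * r := by
      calc R * X = 16 * B ^ 2 * (1 + c * ℓ) * (A' * X ^ 3 / (H' * ε ^ 2) * H') := by
            rw [hR]; field_simp
        _ = _ := by rw [← hr2]; ring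
    rw [h1, mul_div_assoc, div_self hr0.ne', mul_one]
    gcongr
  have hfirst : (T + m + 1) * (2 * H') ≤
      32 * B ^ 2 * (1 + c * ℓ) * W + 24 * Δ ^ 2 * W + 2 * V := by
    calc (T + m + 1) * (2 * H') ≤ (R + 1 + (r + 1) + 1) * (2 * H') := by gcongr
      _ = 2 * (R * H') + 2 * (r * H') + 6 * H' := by ring
      _ ≤ _ := by linarith
  have hsecond : ((T + m) / m + 2) * X ≤ 16 * B ^ 2 * (1 + c * ℓ) * V + 8 * Δ * V := by
    have h1 : (T + m) / m ≤ R / r + 2 := by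
      have hm0 : 0 < m := by linarith
      rw [add_div, div_self hm0.ne']
      have : T / m ≤ R / r + 1 := by
        calc T / m ≤ (R + 1) / m := by gcongr
          _ = R / m + 1 / m := add_div _ _ _
          _ ≤ R / r + 1 := by
              gcongr
              rw [div_le_one hm0]; exact hm1
      linarith
    calc ((T + m) / m + 2) * X ≤ (R / r + 2 + 2) * X := by gcongr
      _ = R * X / r + 4 * X := by ring
      _ ≤ _ := by linarith
  have hfac : (1 + c * ℓ) ≤ (2 + c) * ℓ := by linarith
  have h1c : 1 ≤ 1 + c * ℓ := by linarith
  calc _ ≤ 32 * B ^ 2 * (1 + c * ℓ) * W + 24 * Δ ^ 2 * W + 2 * V +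
        (16 * B ^ 2 * (1 + c * ℓ) * V + 8 * Δ * V) := add_le_add hfirst hsecond
    _ ≤ 32 * B ^ 2 * (1 + c * ℓ) * W + 24 * Δ ^ 2 * (1 + c * ℓ) * W + 2 * (1 + c * ℓ) * V +
        (16 * B ^ 2 * (1 + c * ℓ) * V + 8 * Δ * (1 + c * ℓ) * V) := by
        have h1 := le_mul_of_one_le_right (show 0 ≤ 24 * Δ ^ 2 * W by positivity) h1c
        have h2 := le_mul_of_one_le_right (show 0 ≤ 2 * V by positivity) h1c
        have h3 := le_mul_of_one_le_right (show 0 ≤ 8 * Δ * V by positivity) h1c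
        linarith
    _ ≤ (32 * B ^ 2 + 24 * Δ ^ 2 + 8 * Δ + 2) * (1 + c * ℓ) * (W + 2 * V) := by
        have hu : 0 ≤ 1 + c * ℓ := by linarith
        have e : (32 * B ^ 2 + 24 * Δ ^ 2 + 8 * Δ + 2) * (1 + c * ℓ) * (W + 2 * V) -
          (32 * B ^ 2 * (1 + c * ℓ) * W + 24 * Δ ^ 2 * (1 + c * ℓ) * W + 2 * (1 + c * ℓ) * V +
            (16 * B ^ 2 * (1 + c * ℓ) * V + 8 * Δ * (1 + c * ℓ) * V)) =
          (1 + c * ℓ) * ((8 * Δ + 2) * W + (48 * B ^ 2 + 48 * Δ ^ 2 + 8 * Δ + 2) * V) := by ring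
        have : 0 ≤ (1 + c * ℓ) *
            ((8 * Δ + 2) * W + (48 * B ^ 2 + 48 * Δ ^ 2 + 8 * Δ + 2) * V) := by positivity
        linarith
    _ ≤ _ := by
        rw [mul_assoc _ (2 + c) ℓ]
        gcongr

namespace EFG

variable {Act Info : Type*} [Fintype Act] [Fintype Info] (G : EFG Act Info)

/-! ### The sizes of restricted games -/

variable {P Q : Info → Finset Act}

lemma Allowed.mono (hPQ : P ≤ Q) {h : List Act} (hh : G.Allowed P h) : G.Allowed Q h := by
  induction h with
  | nil => trivial
  | cons a h ih => exact ⟨ih hh.1, fun s hs => hPQ s (hh.2 s hs)⟩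

lemma restrInfosets_mono (hPQ : P ≤ Q) (i : Fin 2) :
    G.restrInfosets P i ⊆ G.restrInfosets Q i := by
  intro s hs
  rw [mem_restrInfosets] at hs ⊢
  obtain ⟨ho, h, hh, ha⟩ := hs
  exact ⟨ho, h, hh, ha.mono G hPQ⟩

lemma restrSize_mono (hPQ : P ≤ Q) : G.restrSize P ≤ G.restrSize Q :=
  Finset.sum_le_sum fun i _ => Finset.card_le_card (G.restrInfosets_mono hPQ i)

lemma restrActs_mono (hPQ : P ≤ Q) : G.restrActs P ≤ G.restrActs Q :=
  Finset.sup_mono_fun fun i _ => (Finset.sup_mono_fun fun s _ => Finset.card_le_card (hPQ s)).trans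
    (Finset.sup_mono (G.restrInfosets_mono hPQ i))

lemma restrHorizon_mono (hPQ : P ≤ Q) : G.restrHorizon P ≤ G.restrHorizon Q :=
  Finset.sup_mono_fun fun _ _ => Finset.sup_mono fun h hh => by
    rw [Finset.mem_filter] at hh ⊢
    exact ⟨hh.1, hh.2.mono G hPQ⟩

lemma length_experience_le {h : List Act} (hh : h ∈ G.hist) (ha : G.Allowed P h) (i : Fin 2) :
    (G.experience i h).length ≤ G.restrHorizon P :=
  (Finset.le_sup (f := fun h => (G.experience i h).length)
      (Finset.mem_filter.2 ⟨hh, ha⟩)).trans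
    (Finset.le_sup (f := fun i => (G.hist.filter fun h => G.Allowed P h).sup
      fun h => (G.experience i h).length) (Finset.mem_univ i))

lemma visited_le {z : List Act} (hz : z ∈ G.hist) (ha : G.Allowed P z) :
    G.visited z ≤ 2 * G.restrHorizon P := by
  unfold visited
  rw [Fin.sum_univ_two]
  have h0 := G.length_experience_le hz ha 0
  have h1 := G.length_experience_le hz ha 1
  omega

/-- If the players move at all, then some node of theirs is reached by chance alone. -/
lemma exists_mem_restrInfosets [Nonempty Info] (P : Info → Finset Act) :
    ∃ s, s ∈ G.restrInfosets P (G.owner s) := by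
  have key : ∀ h ∈ G.hist, G.Allowed P h ∨ ∃ s, ∃ h' ∈ G.nodes s, G.Allowed P h' := by
    intro h
    induction h with
    | nil => exact fun _ => Or.inl trivial
    | cons a h ih =>
      intro hh
      rcases ih (G.tail_mem _ _ hh) with ha | hex
      · cases hs : G.info h with
        | none => exact Or.inl ⟨ha, fun s hs' => by rw [hs] at hs'; cases hs'⟩
        | some s => exact Or.inr ⟨s, h, G.mem_nodes_of_cons hh hs, ha⟩
      · exact Or.inr hex
  obtain ⟨s⟩ := ‹Nonempty Info›
  obtain ⟨h, hh, hne, hs⟩ := G.exists_node s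
  rcases key h hh with ha | ⟨s', h', hh', ha⟩
  · exact ⟨s, G.mem_restrInfosets.2 ⟨rfl, h, G.mem_nodes.2 ⟨hh, hne, hs⟩, ha⟩⟩
  · exact ⟨s', G.mem_restrInfosets.2 ⟨rfl, h', hh', ha⟩⟩

lemma one_le_restr [Nonempty Info] (hP : ∀ s, (P s).Nonempty ∧ P s ⊆ G.acts s) :
    1 ≤ G.restrSize P ∧ 1 ≤ G.restrActs P ∧ 1 ≤ G.restrHorizon P := by
  obtain ⟨s, hs⟩ := G.exists_mem_restrInfosets P
  refine ⟨?_, (hP s).1.card_pos.trans_le (G.card_pop_le_restrActs hs), ?_⟩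
  · exact (Finset.card_pos.2 ⟨s, hs⟩).trans_le
      (Finset.single_le_sum (f := fun i => (G.restrInfosets P i).card) (fun _ _ => Nat.zero_le _)
        (Finset.mem_univ (G.owner s)))
  · obtain ⟨_, h, hh, ha⟩ := G.mem_restrInfosets.1 hs
    obtain ⟨hhist, hne, hinfo⟩ := G.mem_nodes.1 hh
    obtain ⟨a, haP⟩ := (hP s).1
    have h1 : a :: h ∈ G.hist := (G.mem_acts h hhist hne s hinfo a).1 ((hP s).2 haP)
    have h2 : G.Allowed P (a :: h) := ⟨ha, fun s' hs' => by
      rw [hinfo] at hs'; obtain rfl := Option.some.inj hs'; exact haP⟩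
    refine le_trans ?_ (G.length_experience_le h1 h2 (G.owner s))
    simp [experience, hinfo]

lemma sadoBound_mul (ε : ℝ) (k X : ℕ) : G.sadoBound ε k X = k * G.sadoBound ε 1 X := by
  unfold sadoBound; push_cast; ring

lemma sadoBound_one (ε : ℝ) (X : ℕ) : G.sadoBound ε 1 X =
    (G.maxActs : ℝ) * G.horizon * (X : ℝ) ^ 2 / ε ^ 2 +
      2 * (√((G.maxActs : ℝ) * G.horizon) * (X : ℝ) ^ (1.5 : ℝ) / ε) := by
  unfold sadoBound; push_cast; ring

lemma sadoBound_mono {ε : ℝ} (hε : 0 < ε) {X X' : ℕ} (h : X ≤ X') :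
    G.sadoBound ε 1 X ≤ G.sadoBound ε 1 X' := by
  unfold sadoBound
  have h' : (X : ℝ) ≤ X' := by exact_mod_cast h
  gcongr

lemma sadoBound_nonneg {ε : ℝ} (hε : 0 < ε) (k X : ℕ) : 0 ≤ G.sadoBound ε k X := by
  unfold sadoBound; positivity

lemma logFactor_mono {ε p : ℝ} (hε : 0 < ε) (hp : 0 < p) {k k' X X' : ℕ} (hk : k ≤ k')
    (hX : X ≤ X') : G.logFactor ε p k X ≤ G.logFactor ε p k' X' := by
  unfold logFactor
  have hk' : (k : ℝ) ≤ k' := by exact_mod_cast hk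
  have hX' : (X : ℝ) ≤ X' := by exact_mod_cast hX
  gcongr

lemma one_le_two_mul_logFactor {ε p : ℝ} (hε : 0 < ε) (hp : 0 < p) (k X : ℕ) :
    1 ≤ 2 * G.logFactor ε p k X := by
  have h1 : Real.log 2 ≤ G.logFactor ε p k X := by
    unfold logFactor
    refine Real.log_le_log (by norm_num) (le_add_of_nonneg_right (by positivity))
  have := Real.log_two_gt_d9
  linarith

/-- Confidence terms are logarithmic in the parameters. -/
lemma neg_log_failureShare_le {Δ ε p : ℝ} (hΔ : 0 < Δ) (hε : 0 < ε) (hεΔ : ε ≤ 2 * Δ)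
    (hp : 0 < p) (hp1 : p ≤ 1) (j : ℕ) (hX : 1 ≤ G.restrSize P) (hA : 1 ≤ G.restrActs P)
    (hH : 1 ≤ G.restrHorizon P) (hP : P ≤ G.acts) :
    0 < G.failureShare p j P ∧ 0 ≤ -Real.log (G.failureShare p j P) ∧
    -Real.log (G.failureShare p j P) ≤
      (2 * Real.log (8 * Δ ^ 2 + 1) + 2) * G.logFactor ε p (j + 1) (G.restrSize P) := by
  have hX' : (1 : ℝ) ≤ G.restrSize P := by exact_mod_cast hX
  have hA' : (1 : ℝ) ≤ G.restrActs P := by exact_mod_cast hA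
  have hAA : (G.restrActs P : ℝ) ≤ G.maxActs := by exact_mod_cast G.restrActs_mono hP
  have hHH : (1 : ℝ) ≤ G.horizon := by exact_mod_cast hH.trans (G.restrHorizon_mono hP)
  set X : ℝ := (G.restrSize P : ℝ) with hXdef
  set A' : ℝ := (G.restrActs P : ℝ) with hA'def
  have hj : (0 : ℝ) ≤ j := Nat.cast_nonneg j
  have hXA : 1 ≤ X * A' := one_le_mul_of_one_le_of_one_le hX' hA'
  have hq : 0 < G.failureShare p j P := by unfold failureShare; positivity
  have hq1 : G.failureShare p j P ≤ 1 := by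
    unfold failureShare
    rw [div_le_one (by positivity)]
    have h1 : (1 : ℝ) ≤ (j + 1) * (j + 2) := by nlinarith
    exact hp1.trans (one_le_mul_of_one_le_of_one_le h1 hXA)
  refine ⟨hq, neg_nonneg.2 (Real.log_nonpos hq.le hq1), ?_⟩
  have h2ℓ := G.one_le_two_mul_logFactor hε hp (j + 1) (G.restrSize P)
  set y : ℝ := ((j + 1 : ℕ) : ℝ) * G.maxActs * G.horizon * X / (ε * p) with hy
  have hy0 : 0 ≤ y := by positivity
  have hℓ : G.logFactor ε p (j + 1) (G.restrSize P) = Real.log (2 + y) := rfl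
  have hbase : (j + 1) * X * A' / p ≤ 2 * Δ * y := by
    have : ε * y = (j + 1) * X * (G.maxActs * G.horizon) / p := by
      rw [hy]; push_cast; field_simp
    calc (j + 1) * X * A' / p ≤ (j + 1) * X * (G.maxActs * G.horizon) / p := by
          gcongr
          exact hAA.trans (le_mul_of_one_le_right (by positivity) hHH)
      _ = ε * y := this.symm
      _ ≤ 2 * Δ * y := by gcongr
  have hinv : (G.failureShare p j P)⁻¹ ≤ (8 * Δ ^ 2 + 1) * (2 + y) ^ 2 := by
    have e : (G.failureShare p j P)⁻¹ = (j + 1) * (j + 2) * (X * A') / p := by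
      unfold failureShare; rw [inv_div]
    have h1 : (1 : ℝ) ≤ X * A' / p := by
      rw [le_div_iff₀ hp]; linarith
    calc (G.failureShare p j P)⁻¹ = (j + 1) * (j + 2) * (X * A' / p) * 1 := by rw [e]; ring
      -- squared so as to compare with `logFactor`, in which `k` enters only linearly
      _ ≤ (j + 1) * (2 * (j + 1)) * (X * A' / p) * (X * A' / p) := by
          gcongr
          linarith
      _ = 2 * ((j + 1) * X * A' / p) ^ 2 := by ring
      _ ≤ 2 * (2 * Δ * y) ^ 2 := by gcongr
      _ = 8 * Δ ^ 2 * y ^ 2 := by ring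
      _ ≤ (8 * Δ ^ 2 + 1) * (2 + y) ^ 2 := by gcongr <;> linarith
  have hD : 0 ≤ Real.log (8 * Δ ^ 2 + 1) := Real.log_nonneg (by nlinarith)
  calc -Real.log (G.failureShare p j P) = Real.log (G.failureShare p j P)⁻¹ :=
        (Real.log_inv _).symm
    _ ≤ Real.log ((8 * Δ ^ 2 + 1) * (2 + y) ^ 2) := Real.log_le_log (inv_pos.2 hq) hinv
    _ = Real.log (8 * Δ ^ 2 + 1) + 2 * Real.log (2 + y) := by
        rw [Real.log_mul (by positivity) (by positivity), Real.log_pow]; push_cast; ring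
    _ ≤ _ := by
        -- `logFactor` is at least `1 / 2`, so it absorbs the constant
        rw [hℓ] at h2ℓ ⊢
        nlinarith

/-! ### The length of a window -/

variable {ε : ℝ} {br : Fin 2 → (Info → Act → ℝ) → Info → Act}
  {ξ : (Info → Finset Act) → (Info → Act → ℝ) → Info → Act → ℝ} {w : ℕ → List Act} {p M : ℝ}

lemma exp_le_sum_exp (x : Info → Act → ℝ) {i : Fin 2} {s : Info} (hs : s ∈ G.restrInfosets P i)
    {a : Act} (ha : a ∈ P s) :
    Real.exp (x s a) ≤ ∑ i, ∑ s ∈ G.restrInfosets P i, ∑ a ∈ P s, Real.exp (x s a) := by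
  have h0 : ∀ s, 0 ≤ ∑ a ∈ P s, Real.exp (x s a) :=
    fun s => Finset.sum_nonneg fun a _ => (Real.exp_pos _).le
  calc Real.exp (x s a) ≤ ∑ a ∈ P s, Real.exp (x s a) :=
        Finset.single_le_sum (f := fun a => Real.exp (x s a)) (fun _ _ => (Real.exp_pos _).le) ha
    _ ≤ ∑ s ∈ G.restrInfosets P i, ∑ a ∈ P s, Real.exp (x s a) :=
        Finset.single_le_sum (f := fun s => ∑ a ∈ P s, Real.exp (x s a)) (fun s _ => h0 s) hs
    _ ≤ _ := Finset.single_le_sum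
          (f := fun i => ∑ s ∈ G.restrInfosets P i, ∑ a ∈ P s, Real.exp (x s a))
          (fun i _ => Finset.sum_nonneg fun s _ => h0 s) (Finset.mem_univ i)

/-- On the event that the failure potential is below `1`, the noise of the window is small. -/
lemma windowNoise_le (hp : 0 ≤ p) {t : ℕ}
    (hq : 0 < G.failureShare p (G.run ε br ξ w t).window (G.run ε br ξ w t).pop)
    (hl : 0 < G.tilt ε M (G.run ε br ξ w t).pop)
    (hΦ : G.failurePotential ε br ξ p M t w < 1) {i : Fin 2} {s : Info}
    (hs : s ∈ G.restrInfosets (G.run ε br ξ w t).pop i) {a : Act}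
    (ha : a ∈ (G.run ε br ξ w t).pop s) :
    G.windowNoise ε br ξ w t s a ≤
      (t - G.windowStart ε br ξ w t : ℕ) * (G.tilt ε M (G.run ε br ξ w t).pop * M ^ 2 / 2) +
      -Real.log (G.failureShare p (G.run ε br ξ w t).window (G.run ε br ξ w t).pop) /
        G.tilt ε M (G.run ε br ξ w t).pop := by
  simp only [failurePotential] at hΦ
  set P := (G.run ε br ξ w t).pop with hP
  set j := (G.run ε br ξ w t).window with hj
  set l := G.tilt ε M P with hldef
  set n : ℝ := ((t - G.windowStart ε br ξ w t : ℕ) : ℝ) with hn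
  set x : Info → Act → ℝ := fun s a =>
    l * G.windowNoise ε br ξ w t s a - n * (l ^ 2 * M ^ 2 / 2) with hx
  have h1 : Real.exp (x s a) ≤ ∑ i, ∑ s ∈ G.restrInfosets P i, ∑ a ∈ P s, Real.exp (x s a) :=
    G.exp_le_sum_exp x hs ha
  have h2 : G.failureShare p j P * Real.exp (x s a) < 1 := by
    have := mul_le_mul_of_nonneg_left h1 hq.le
    have h0 : 0 ≤ p / ((j : ℝ) + 2) := by positivity
    linarith
  have h3 : x s a ≤ -Real.log (G.failureShare p j P) := by
    rw [← Real.log_inv, Real.le_log_iff_exp_le (inv_pos.2 hq), ← one_div, le_div_iff₀ hq]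
    linarith
  have h4 : x s a / l = G.windowNoise ε br ξ w t s a - n * (l * M ^ 2 / 2) := by
    rw [div_eq_iff hl.ne']
    simp only [hx]
    ring
  have h5 := div_le_div_of_nonneg_right h3 hl.le
  linarith

/-- After an oracle call that does not enlarge the population in a sufficiently long window, the
last-window average strategy is an equilibrium, unless the noise has been too large. -/
lemma isNash_of_long_window [Nonempty Info] (hG : G.PerfectRecall) {Δ δ : ℝ} (hΔ0 : 0 < Δ)
    (hδ : 0 < δ) (hΔ : ∀ z ∈ G.terminals, |G.payoff z| ≤ Δ) (hbr : G.IsBestResponseOracle br)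
    (hξ : G.IsSamplingScheme δ ξ) (hε : 0 < ε) (hεΔ : ε ≤ 2 * Δ) (hp : 0 < p) (hp1 : p ≤ 1)
    {t : ℕ} (hΦ : G.failurePotential ε br ξ p (2 * (Δ / δ)) (t + 1) w < 1)
    (hw : ∀ u, w (u + 1) ∈ G.terminals)
    (hmod : (t + 1) % G.frequency ε (G.run ε br ξ w t).pop = 0)
    (hpop : (G.run ε br ξ w (t + 1)).pop = (G.run ε br ξ w t).pop)
    (hlong : 16 * (Δ / δ) ^ 2 * (G.restrSize (G.run ε br ξ w t).pop : ℝ) ^ 2 *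
      (G.restrActs (G.run ε br ξ w t).pop + -Real.log
        (G.failureShare p (G.run ε br ξ w t).window (G.run ε br ξ w t).pop)) / ε ^ 2 ≤
      (t + 1 - G.windowStart ε br ξ w t : ℕ)) :
    G.IsNash ε (G.lastWindowAverage (G.run ε br ξ w t)) := by
  have hpopS := G.pop_run (ε := ε) (ξ := ξ) (w := w) hbr t
  obtain ⟨hX, hA, hH⟩ := G.one_le_restr hpopS
  have hexp := G.expand_eq_of_pop_eq hmod hpop
  have hstart := G.windowStart_succ_of_pop_eq hpop
  have hwin := (G.run_succ_of_pop_eq hpop).1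
  obtain ⟨hq, hL0, -⟩ := G.neg_log_failureShare_le hΔ0 hε hεΔ hp hp1
    (G.run ε br ξ w t).window hX hA hH fun s => (hpopS s).2
  have hnoise := fun i s hs a ha => G.windowNoise_le (i := i) (s := s) (a := a) (M := 2 * (Δ / δ))
    hp.le (t := t + 1) (by rw [hpop, hwin]; exact hq)
    (by
      unfold tilt
      rw [hpop]
      have : (0 : ℝ) < G.restrSize (G.run ε br ξ w t).pop := by exact_mod_cast hX
      positivity) hΦ hs ha
  have hreg := fun s hs a ha => G.regret_le hG hδ hΔ0.le hΔ hbr hξ (t + 1) (w := w) (ε := ε)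
    (fun u _ => hw u) (s := s) hs (a := a) ha
  rw [hpop] at hnoise hreg
  rw [hwin, hstart] at hnoise
  rw [hstart] at hreg
  have hsum := fun s a => G.sum_cfRegret_eq (ε := ε) (br := br) (ξ := ξ) (w := w) (t + 1) s a
  rw [hstart] at hsum
  rw [lastWindowAverage_run] at hexp ⊢
  set P := (G.run ε br ξ w t).pop with hPdef
  set L := -Real.log (G.failureShare p (G.run ε br ξ w t).window P) with hL
  set n : ℕ := t + 1 - G.windowStart ε br ξ w t with hn
  set B := Δ / δ with hB
  have hB0 : 0 < B := by positivity
  have hX' : (1 : ℝ) ≤ G.restrSize P := by exact_mod_cast hX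
  have hn0 : (0 : ℝ) ≤ n := Nat.cast_nonneg n
  refine G.isNash_averageStrategy hG (fun s => (hpopS s).1) (fun s => (hpopS s).2) hbr
    (Finset.nonempty_Ico.2 (Nat.lt_succ_of_le (G.windowStart_le t)))
    (fun u hu => ?_) (fun s => ?_)
    (Y := B * √(n * G.restrActs P) + (n * (G.tilt ε (2 * B) P * (2 * B) ^ 2 / 2) +
      L / G.tilt ε (2 * B) P)) ?_ ?_ ?_
  · rw [Finset.mem_Ico] at hu
    exact G.isStrategyOn_play_of_window hbr hu.1 (by omega)
  · have := congrFun hexp s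
    rw [← this]
    exact Finset.mem_insert_self _ _
  · unfold tilt; positivity
  · rw [Nat.card_Ico, ← hn]
    set X : ℝ := (G.restrSize P : ℝ) with hXdef
    set A : ℝ := (G.restrActs P : ℝ) with hAdef
    have hA0 : 0 ≤ A := Nat.cast_nonneg _
    have hX0 : 0 < X := by linarith
    rw [div_le_iff₀ (by positivity)] at hlong
    have hLn : 16 * B ^ 2 * X ^ 2 * L ≤ n * ε ^ 2 := by
      refine le_trans ?_ hlong
      gcongr
      linarith
    have hAn : 16 * B ^ 2 * X ^ 2 * A ≤ n * ε ^ 2 := by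
      refine le_trans ?_ hlong
      gcongr
      linarith
    -- the budget `ε n` is split between the sampled regret, the drift of the exponential
    -- supermartingale (which the choice of `tilt` makes exactly half of it) and the confidence term
    have h1 : X * (B * √(n * A)) ≤ ε * n / 4 := by
      refine le_of_sq_le_sq ?_ (by positivity)
      rw [mul_pow, mul_pow, Real.sq_sqrt (by positivity)]
      nlinarith
    have h2 : X * (n * (G.tilt ε (2 * B) P * (2 * B) ^ 2 / 2)) = ε * n / 2 := by
      unfold tilt; rw [← hXdef]; field_simp
    have h3 : X * (L / G.tilt ε (2 * B) P) ≤ ε * n / 4 := by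
      have : X * (L / G.tilt ε (2 * B) P) = 4 * B ^ 2 * X ^ 2 * L / ε := by
        unfold tilt; rw [← hXdef]; field_simp; ring
      rw [this, div_le_iff₀ hε]
      nlinarith
    rw [mul_add, mul_add]
    linarith
  · intro i s hs a ha
    obtain rfl := (G.mem_restrInfosets.1 hs).1
    rw [hsum]
    exact add_le_add (hreg s hs a ha) (hnoise _ s hs a ha)

/-- The number of iterations after which the average regret of a window is small. -/
def learningTime (Δ δ ε p : ℝ) (j : ℕ) (P : Info → Finset Act) : ℕ :=
  ⌈16 * (Δ / δ) ^ 2 * (G.restrSize P : ℝ) ^ 2 *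
    (G.restrActs P + -Real.log (G.failureShare p j P)) / ε ^ 2⌉₊

lemma frequency_pos [Nonempty Info] (hε : 0 < ε) (hP : ∀ s, (P s).Nonempty ∧ P s ⊆ G.acts s) :
    0 < G.frequency ε P := by
  obtain ⟨hX, hA, hH⟩ := G.one_le_restr hP
  have hX' : (0 : ℝ) < G.restrSize P := by exact_mod_cast hX
  have hA' : (0 : ℝ) < G.restrActs P := by exact_mod_cast hA
  have hH' : (0 : ℝ) < G.restrHorizon P := by exact_mod_cast hH
  unfold frequency
  rw [Nat.ceil_pos]
  positivity

/-- A window lasts until the first oracle call after its learning time. -/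
lemma sub_windowStart_le [Nonempty Info] (hG : G.PerfectRecall) {Δ δ : ℝ} (hΔ0 : 0 < Δ)
    (hδ : 0 < δ) (hΔ : ∀ z ∈ G.terminals, |G.payoff z| ≤ Δ) (hbr : G.IsBestResponseOracle br)
    (hξ : G.IsSamplingScheme δ ξ) (hε : 0 < ε) (hεΔ : ε ≤ 2 * Δ) (hp : 0 < p) (hp1 : p ≤ 1)
    (hΦ : ∀ t, G.failurePotential ε br ξ p (2 * (Δ / δ)) t w < 1)
    (hw : ∀ u, w (u + 1) ∈ G.terminals) {t : ℕ}
    (ht : ∀ u < t, ¬ G.IsNash ε (G.lastWindowAverage (G.run ε br ξ w u))) :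
    t - G.windowStart ε br ξ w t ≤
      G.learningTime Δ δ ε p (G.run ε br ξ w t).window (G.run ε br ξ w t).pop +
        G.frequency ε (G.run ε br ξ w t).pop := by
  set P := (G.run ε br ξ w t).pop with hP
  set m := G.frequency ε P with hm
  set T := G.learningTime Δ δ ε p (G.run ε br ξ w t).window P with hT
  set a := G.windowStart ε br ξ w t with ha
  have hm0 : 0 < m := G.frequency_pos hε (G.pop_run hbr t)
  by_contra hlt
  push Not at hlt
  -- the first multiple of `m` after `a + T`
  set v := m * ((a + T) / m + 1) with hv
  have hv1 : a + T < v := Nat.lt_mul_div_succ _ hm0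
  have hv2 : v ≤ a + T + m := by
    rw [hv, mul_add, mul_one]
    exact Nat.add_le_add_right (Nat.mul_div_le _ _) _
  obtain ⟨u, hu⟩ : ∃ u, v = u + 1 := ⟨v - 1, by omega⟩
  obtain ⟨h1, h2⟩ := G.pop_eq_and_windowStart_eq (ε := ε) (br := br) (ξ := ξ) (w := w) (t := t)
    (u := u) (by omega) (by omega)
  obtain ⟨h3, h4⟩ := G.pop_eq_and_windowStart_eq (ε := ε) (br := br) (ξ := ξ) (w := w) (t := t)
    (u := u + 1) (by omega) (by omega)
  have hwin : (G.run ε br ξ w u).window = (G.run ε br ξ w t).window := by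
    have : ∀ v, u ≤ v → v ≤ t → (G.run ε br ξ w v).window = (G.run ε br ξ w u).window := by
      intro v huv
      induction v, huv using Nat.le_induction with
      | base => exact fun _ => rfl
      | succ v huv ih =>
        intro hvt
        have h5 := (G.pop_eq_and_windowStart_eq (ε := ε) (br := br) (ξ := ξ) (w := w) (t := t)
          (u := v) (by omega) (by omega)).1
        have h6 := (G.pop_eq_and_windowStart_eq (ε := ε) (br := br) (ξ := ξ) (w := w) (t := t)
          (u := v + 1) (by omega) (by omega)).1
        rw [(G.run_succ_of_pop_eq (h6.trans h5.symm)).1, ih (by omega)]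
    exact (this t (by omega) le_rfl).symm
  refine ht u (by omega) (G.isNash_of_long_window hG hΔ0 hδ hΔ hbr hξ hε hεΔ hp hp1 (hΦ (u + 1))
    hw ?_ (h3.trans h1.symm) ?_)
  · rw [h1, ← hP, ← hm, ← hu, hv]
    exact Nat.mul_mod_right _ _
  · rw [h1, h2, hwin, ← hP]
    refine (Nat.le_ceil _).trans ?_
    exact Nat.cast_le.2 (show T ≤ u + 1 - a by omega)

/-! ### Sample complexity -/

/-- The constant in the bound on the cost of a single window. -/
def windowConst (Δ δ : ℝ) : ℝ :=
  (32 * (Δ / δ) ^ 2 + 24 * Δ ^ 2 + 8 * Δ + 2) * (2 + (2 * Real.log (8 * Δ ^ 2 + 1) + 2))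

/-- The bound on the cost of the window with index `j` in a restricted game of size `X`. -/
def windowCost (Δ δ ε p : ℝ) (j X : ℕ) : ℝ :=
  windowConst Δ δ * G.logFactor ε p (j + 1) X * G.sadoBound ε 1 X

lemma windowConst_pos {Δ : ℝ} (hΔ : 0 < Δ) (δ : ℝ) : 0 < windowConst Δ δ := by
  have hD : 0 ≤ Real.log (8 * Δ ^ 2 + 1) := Real.log_nonneg (by nlinarith [sq_nonneg Δ])
  unfold windowConst
  positivity

lemma windowCost_mono {Δ : ℝ} (hΔ : 0 < Δ) (δ : ℝ) (hε : 0 < ε) (hp : 0 < p) {j j' X X' : ℕ}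
    (hj : j ≤ j') (hX : X ≤ X') : G.windowCost Δ δ ε p j X ≤ G.windowCost Δ δ ε p j' X' := by
  unfold windowCost
  have h1 := G.logFactor_mono hε hp (Nat.add_le_add_right hj 1) hX
  have h2 := G.one_le_two_mul_logFactor hε hp (j + 1) X
  have h3 := G.one_le_two_mul_logFactor hε hp (j' + 1) X'
  have h4 := G.sadoBound_nonneg hε 1 X
  have h5 := windowConst_pos hΔ δ
  have h6 := G.sadoBound_mono hε hX
  have h7 : 0 ≤ G.logFactor ε p (j' + 1) X' := by linarith
  gcongr

/-- Iterations and oracle calls of a window of length `n + 1`; `a` and `t` are the numbers of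
iterations before the window and before its last iteration. -/
lemma cost_of_window_le [Nonempty Info] {Δ δ : ℝ} (hΔ0 : 0 < Δ)
    (hε : 0 < ε) (hεΔ : ε ≤ 2 * Δ) (hp : 0 < p) (hp1 : p ≤ 1)
    (hP : ∀ s, (P s).Nonempty ∧ P s ⊆ G.acts s) {a t j : ℕ} (hat : a ≤ t)
    (h : t - a ≤ G.learningTime Δ δ ε p j P + G.frequency ε P) :
    ((t - a : ℕ) + 1 : ℝ) * (2 * G.restrHorizon P) +
      (((t / G.frequency ε P : ℕ) : ℝ) - (a / G.frequency ε P : ℕ) + 1) * G.restrSize P ≤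
      G.windowCost Δ δ ε p j (G.restrSize P) := by
  obtain ⟨hX, hA, hH⟩ := G.one_le_restr hP
  have hPa : P ≤ G.acts := fun s => (hP s).2
  obtain ⟨hq, hL0, hL⟩ := G.neg_log_failureShare_le hΔ0 hε hεΔ hp hp1 j hX hA hH hPa
  have hm0 := G.frequency_pos hε hP
  have hD : 0 ≤ Real.log (8 * Δ ^ 2 + 1) := Real.log_nonneg (by nlinarith [sq_nonneg Δ])
  have key := window_cost_le (B := Δ / δ) (X := G.restrSize P) (A := G.maxActs)
    (A' := G.restrActs P) (H := G.horizon) (H' := G.restrHorizon P)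
    (T := G.learningTime Δ δ ε p j P) (m := G.frequency ε P) hε hεΔ
    (by exact_mod_cast hX) (by exact_mod_cast hA) (by exact_mod_cast hH)
    (by exact_mod_cast G.restrActs_mono hPa) (by exact_mod_cast G.restrHorizon_mono hPa)
    hL (by positivity) (G.one_le_two_mul_logFactor hε hp _ _)
    (Nat.ceil_lt_add_one (by positivity)).le (by exact_mod_cast hm0) (Nat.le_ceil _)
    (Nat.ceil_lt_add_one (Real.sqrt_nonneg _)).le
  rw [← sadoBound_one] at key
  refine le_trans ?_ key
  set m := G.frequency ε P with hm
  set T := G.learningTime Δ δ ε p j P with hT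
  have hm0' : (0 : ℝ) < m := by exact_mod_cast hm0
  have hn : ((t - a : ℕ) : ℝ) ≤ T + m := by exact_mod_cast h
  have hdiv : ((t / m : ℕ) : ℝ) - (a / m : ℕ) ≤ (T + m) / m + 1 := by
    have h1 : ((t / m : ℕ) : ℝ) ≤ t / m := Nat.cast_div_le
    have h2 : (a : ℝ) / m ≤ (a / m : ℕ) + 1 := by
      rw [div_le_iff₀ hm0', mul_comm]
      exact_mod_cast (Nat.lt_mul_div_succ a hm0).le
    have h3 : (t : ℝ) / m - a / m ≤ (T + m) / m := by
      rw [← sub_div]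
      gcongr
      rw [Nat.cast_sub hat] at hn
      exact hn
    linarith
  refine add_le_add ?_ ?_
  · gcongr
  · exact mul_le_mul_of_nonneg_right (by linarith) (Nat.cast_nonneg _)

lemma window_le_succ_and_restrSize_le_succ (t : ℕ) :
    (G.run ε br ξ w t).window ≤ (G.run ε br ξ w (t + 1)).window ∧
    G.restrSize (G.run ε br ξ w t).pop ≤ G.restrSize (G.run ε br ξ w (t + 1)).pop := by
  refine ⟨?_, G.restrSize_mono (G.pop_run_le_succ t)⟩
  by_cases h : (G.run ε br ξ w (t + 1)).pop = (G.run ε br ξ w t).pop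
  · rw [(G.run_succ_of_pop_eq h).1]
  · rw [(G.run_succ_of_pop_ne h).1]; omega

lemma cost_run_succ_le {t : ℕ}
    (hvis : G.visited (w (t + 1)) ≤ 2 * G.restrHorizon (G.run ε br ξ w t).pop) :
    ((G.run ε br ξ w (t + 1)).cost : ℝ) ≤ (G.run ε br ξ w t).cost +
      2 * G.restrHorizon (G.run ε br ξ w t).pop + G.restrSize (G.run ε br ξ w t).pop := by
  rw [cost_run_succ]
  norm_cast
  split_ifs <;> omega

/-- As long as no equilibrium has been found, every finished window has cost at most
`windowCost` of the present one. -/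
lemma cost_run_le [Nonempty Info] (hG : G.PerfectRecall) {Δ δ : ℝ} (hΔ0 : 0 < Δ)
    (hδ : 0 < δ) (hΔ : ∀ z ∈ G.terminals, |G.payoff z| ≤ Δ) (hbr : G.IsBestResponseOracle br)
    (hξ : G.IsSamplingScheme δ ξ) (hε : 0 < ε) (hεΔ : ε ≤ 2 * Δ) (hp : 0 < p) (hp1 : p ≤ 1)
    (hΦ : ∀ t, G.failurePotential ε br ξ p (2 * (Δ / δ)) t w < 1)
    (hw : ∀ u, w (u + 1) ∈ G.terminals)
    (hvis : ∀ u, G.visited (w (u + 1)) ≤ 2 * G.restrHorizon (G.run ε br ξ w u).pop) {t : ℕ}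
    (ht : ∀ u < t, ¬ G.IsNash ε (G.lastWindowAverage (G.run ε br ξ w u))) :
    ((G.run ε br ξ w t).cost : ℝ) ≤ G.restrSize (G.run ε br ξ w t).pop +
      (G.run ε br ξ w t).window * G.windowCost Δ δ ε p (G.run ε br ξ w t).window
        (G.restrSize (G.run ε br ξ w t).pop) +
      (t - G.windowStart ε br ξ w t : ℕ) * (2 * G.restrHorizon (G.run ε br ξ w t).pop) +
      (((t / G.frequency ε (G.run ε br ξ w t).pop : ℕ) : ℝ) -
        (G.windowStart ε br ξ w t / G.frequency ε (G.run ε br ξ w t).pop : ℕ)) *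
          G.restrSize (G.run ε br ξ w t).pop := by
  induction t with
  | zero => simp [run, initial, windowStart]
  | succ t ih =>
    specialize ih fun u hu => ht u (by omega)
    have hlen := G.sub_windowStart_le hG hΔ0 hδ hΔ hbr hξ hε hεΔ hp hp1 hΦ hw
      (fun u hu => ht u (by omega : u < t + 1))
    have hlen' := G.sub_windowStart_le hG hΔ0 hδ hΔ hbr hξ hε hεΔ hp hp1 hΦ hw
      (fun u (hu : u < t) => ht u (by omega))
    have hv : (G.visited (w (t + 1)) : ℝ) ≤ 2 * G.restrHorizon (G.run ε br ξ w t).pop := by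
      exact_mod_cast hvis t
    by_cases h : (G.run ε br ξ w (t + 1)).pop = (G.run ε br ξ w t).pop
    · rw [cost_run_succ, h, (G.run_succ_of_pop_eq h).1, G.windowStart_succ_of_pop_eq h,
        Nat.succ_div, Nat.succ_sub (G.windowStart_le t)]
      simp only [Nat.dvd_iff_mod_eq_zero]
      split_ifs <;> push_cast <;> linarith
    · have hcost := G.cost_run_succ_le (ε := ε) (br := br) (ξ := ξ) (hvis t)
      have hwc := G.cost_of_window_le (δ := δ) hΔ0 hε hεΔ hp hp1
        (G.pop_run (ε := ε) (ξ := ξ) (w := w) hbr t)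
        (G.windowStart_le t) hlen'
      obtain ⟨hj, hX⟩ := G.window_le_succ_and_restrSize_le_succ (ε := ε) (br := br) (ξ := ξ)
        (w := w) t
      have hmono := G.windowCost_mono hΔ0 δ hε hp hj hX
      have hX' : (G.restrSize (G.run ε br ξ w t).pop : ℝ) ≤
        G.restrSize (G.run ε br ξ w (t + 1)).pop := by exact_mod_cast hX
      have hj1 := (G.run_succ_of_pop_ne h).1
      have hjc : ((G.run ε br ξ w (t + 1)).window : ℝ) = (G.run ε br ξ w t).window + 1 := by
        rw [hj1]; push_cast; rfl
      have hmul := mul_le_mul_of_nonneg_left hmono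
        (show (0 : ℝ) ≤ (G.run ε br ξ w t).window + 1 by positivity)
      rw [G.windowStart_succ_of_pop_ne h, sub_self, Nat.sub_self, hjc]
      push_cast
      linarith

/-- On the event that the noise stays small, an equilibrium is found, at the claimed cost. -/
lemma exists_isLeast_isNash [Nonempty Info] (hG : G.PerfectRecall) {Δ δ : ℝ} (hΔ0 : 0 < Δ)
    (hδ : 0 < δ) (hΔ : ∀ z ∈ G.terminals, |G.payoff z| ≤ Δ) (hbr : G.IsBestResponseOracle br)
    (hξ : G.IsSamplingScheme δ ξ) (hε : 0 < ε) (hεΔ : ε ≤ 2 * Δ) (hp : 0 < p) (hp1 : p ≤ 1)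
    (hΦ : ∀ t, G.failurePotential ε br ξ p (2 * (Δ / δ)) t w < 1)
    (hw : ∀ u, w (u + 1) ∈ G.terminals)
    (hreach : ∀ u, G.reach (G.sampling ε br ξ w u) (w (u + 1)) ≠ 0) :
    ∃ t, IsLeast {n | G.IsNash ε (G.lastWindowAverage (G.run ε br ξ w n))} t ∧
      ((G.run ε br ξ w (t + 1)).cost : ℝ) ≤ (windowConst Δ δ + 2 * Δ) *
        G.sadoBound ε ((G.run ε br ξ w t).window + 1) (G.restrSize (G.run ε br ξ w t).pop) *
        G.logFactor ε p ((G.run ε br ξ w t).window + 1)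
          (G.restrSize (G.run ε br ξ w t).pop) ^ 1 := by
  have hvis : ∀ u, G.visited (w (u + 1)) ≤ 2 * G.restrHorizon (G.run ε br ξ w u).pop := fun u =>
    G.visited_le (G.mem_terminals.1 (hw u)).1
      (G.allowed_of_reach_ne_zero (G.isStrategyOn_sampling hbr hξ u) (hreach u))
  have hex : ∃ t, G.IsNash ε (G.lastWindowAverage (G.run ε br ξ w t)) := by
    by_contra hno
    push Not at hno
    -- otherwise the window in which the population stabilizes would last too long
    obtain ⟨t₀, h0⟩ := G.exists_windowStart_eq (ε := ε) (br := br) (ξ := ξ) (w := w)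
    have hlen : ∀ t, t₀ ≤ t → t - G.windowStart ε br ξ w t₀ ≤
        G.learningTime Δ δ ε p (G.run ε br ξ w t₀).window (G.run ε br ξ w t₀).pop +
          G.frequency ε (G.run ε br ξ w t₀).pop := by
      intro t ht
      have := G.sub_windowStart_le hG hΔ0 hδ hΔ hbr hξ hε hεΔ hp hp1 hΦ hw
        (t := t) fun u _ => hno u
      rwa [(h0 t ht).1, (h0 t ht).2.1, (h0 t ht).2.2] at this
    have h1 := hlen (t₀ + G.windowStart ε br ξ w t₀ +
      (G.learningTime Δ δ ε p (G.run ε br ξ w t₀).window (G.run ε br ξ w t₀).pop +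
          G.frequency ε (G.run ε br ξ w t₀).pop) + 1) (by omega)
    omega
  refine ⟨Nat.find hex, ⟨Nat.find_spec hex, fun n hn => Nat.find_min' hex hn⟩, ?_⟩
  have ht : ∀ u < Nat.find hex, ¬ G.IsNash ε (G.lastWindowAverage (G.run ε br ξ w u)) :=
    fun u hu => Nat.find_min hex hu
  generalize Nat.find hex = t at ht
  have hcost := G.cost_run_le hG hΔ0 hδ hΔ hbr hξ hε hεΔ hp hp1 hΦ hw hvis ht
  have hlen := G.sub_windowStart_le hG hΔ0 hδ hΔ hbr hξ hε hεΔ hp hp1 hΦ hw ht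
  have hpopS := G.pop_run (ε := ε) (ξ := ξ) (w := w) hbr t
  have hwc := G.cost_of_window_le (δ := δ) hΔ0 hε hεΔ hp hp1 hpopS (G.windowStart_le t) hlen
  have hstep := G.cost_run_succ_le (ε := ε) (br := br) (ξ := ξ) (hvis t)
  obtain ⟨hX, hA, hH⟩ := G.one_le_restr hpopS
  have hPa : (G.run ε br ξ w t).pop ≤ G.acts := fun s => (hpopS s).2
  have hℓ := G.one_le_two_mul_logFactor hε hp ((G.run ε br ξ w t).window + 1)
    (G.restrSize (G.run ε br ξ w t).pop)
  have hS0 := G.sadoBound_nonneg hε 1 (G.restrSize (G.run ε br ξ w t).pop)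
  have hXS : (G.restrSize (G.run ε br ξ w t).pop : ℝ) ≤
      Δ * G.sadoBound ε 1 (G.restrSize (G.run ε br ξ w t).pop) := by
    have hX' : (1 : ℝ) ≤ G.restrSize (G.run ε br ξ w t).pop := by exact_mod_cast hX
    have hA' : (1 : ℝ) ≤ G.maxActs := by exact_mod_cast hA.trans (G.restrActs_mono hPa)
    have hH' : (1 : ℝ) ≤ G.horizon := by exact_mod_cast hH.trans (G.restrHorizon_mono hPa)
    set X : ℝ := (G.restrSize (G.run ε br ξ w t).pop : ℝ) with hXdef
    have h1 : X ≤ √((G.maxActs : ℝ) * G.horizon) * X ^ (1.5 : ℝ) := by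
      have h2 : 1 ≤ √((G.maxActs : ℝ) * G.horizon) :=
        Real.one_le_sqrt.2 (one_le_mul_of_one_le_of_one_le hA' hH')
      have h3 : X ≤ X ^ (1.5 : ℝ) := by
        conv_lhs => rw [← Real.rpow_one X]
        exact Real.rpow_le_rpow_of_exponent_le hX' (by norm_num)
      exact h3.trans (le_mul_of_one_le_left (by positivity) h2)
    rw [sadoBound_one, ← hXdef, mul_add]
    have h4 : X ≤ Δ * (2 * (√((G.maxActs : ℝ) * G.horizon) * X ^ (1.5 : ℝ) / ε)) := by
      rw [show Δ * (2 * (√((G.maxActs : ℝ) * G.horizon) * X ^ (1.5 : ℝ) / ε)) =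
        2 * Δ * (√((G.maxActs : ℝ) * G.horizon) * X ^ (1.5 : ℝ)) / ε by ring, le_div_iff₀ hε]
      calc X * ε ≤ (√((G.maxActs : ℝ) * G.horizon) * X ^ (1.5 : ℝ)) * (2 * Δ) := by gcongr
        _ = _ := by ring
    refine h4.trans (le_add_of_nonneg_left (by positivity))
  rw [sadoBound_mul, pow_one]
  have hkc : (((G.run ε br ξ w t).window + 1 : ℕ) : ℝ) = (G.run ε br ξ w t).window + 1 := by
    push_cast; rfl
  rw [hkc]
  set S := G.sadoBound ε 1 (G.restrSize (G.run ε br ξ w t).pop) with hS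
  set ℓ := G.logFactor ε p ((G.run ε br ξ w t).window + 1)
    (G.restrSize (G.run ε br ξ w t).pop) with hℓdef
  set j : ℝ := ((G.run ε br ξ w t).window : ℝ) with hj
  have hF : G.windowCost Δ δ ε p (G.run ε br ξ w t).window
      (G.restrSize (G.run ε br ξ w t).pop) = windowConst Δ δ * ℓ * S := rfl
  rw [hF] at hcost hwc
  have hj0 : 0 ≤ j := Nat.cast_nonneg _
  have hXfin : (G.restrSize (G.run ε br ξ w t).pop : ℝ) ≤ 2 * Δ * ((j + 1) * S) * ℓ :=
    calc _ ≤ Δ * S := hXS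
      _ = Δ * (1 * S) * 1 := by ring
      _ ≤ Δ * ((j + 1) * S) * (2 * ℓ) := by gcongr; linarith
      _ = _ := by ring
  calc ((G.run ε br ξ w (t + 1)).cost : ℝ)
      ≤ G.restrSize (G.run ε br ξ w t).pop + (j + 1) * (windowConst Δ δ * ℓ * S) := by linarith
    _ ≤ 2 * Δ * ((j + 1) * S) * ℓ + (j + 1) * (windowConst Δ δ * ℓ * S) := by linarith
    _ = _ := by ring

/-- A game in which the players never move: there is nothing to learn. -/
lemma exists_isLeast_isNash_of_isEmpty [IsEmpty Info] (hε : 0 < ε) :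
    ∃ t, IsLeast {n | G.IsNash ε (G.lastWindowAverage (G.run ε br ξ w n))} t ∧
      (G.run ε br ξ w (t + 1)).cost = 0 := by
  have hsize : ∀ P, G.restrSize P = 0 := fun P => by simp [restrSize, restrInfosets]
  have hvis : ∀ z, G.visited z = 0 := fun z => by
    unfold visited
    refine Finset.sum_eq_zero fun i _ => ?_
    rw [List.length_eq_zero_iff, List.eq_nil_iff_forall_not_mem]
    exact fun q _ => isEmptyElim q.1
  refine ⟨0, ⟨⟨fun s => isEmptyElim s, fun i τ _ => ?_⟩, fun n _ => Nat.zero_le n⟩, ?_⟩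
  · rw [Subsingleton.elim (G.deviate i _ τ) (G.lastWindowAverage (G.run ε br ξ w 0)),
      Subsingleton.elim (G.deviate i τ _) (G.lastWindowAverage (G.run ε br ξ w 0))]
    constructor <;> linarith
  · rw [cost_run_succ, hvis]
    simp [run, initial, hsize]

end EFG

end

theorem mainTheorem4 (Δ δ : ℝ) (hΔ : 0 < Δ) (hδ : 0 < δ) :
    ∃ (C : ℝ) (d : ℕ), 0 < C ∧
      ∀ (Act Info : Type*) [Fintype Act] [Fintype Info] (G : EFG Act Info),
        G.PerfectRecall →
        (∀ z ∈ G.terminals, |G.payoff z| ≤ Δ) →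
        ∀ br : Fin 2 → (Info → Act → ℝ) → Info → Act, G.IsBestResponseOracle br →
        ∀ ξ : (Info → Finset Act) → (Info → Act → ℝ) → Info → Act → ℝ,
          G.IsSamplingScheme δ ξ →
        ∀ ε p : ℝ, 0 < ε → ε ≤ 2 * Δ → 0 < p → p ≤ 1 →
        ∀ (Ω : Type*) [MeasurableSpace Ω] (μ : MeasureTheory.Measure Ω)
          [MeasureTheory.IsProbabilityMeasure μ] (ζ : ℕ → Ω → List Act),
          G.IsExecution ε br ξ μ ζ →
          -- `st t` is the state before iteration `t + 1`; its first `t + 1` iterations use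
          -- `(st (t + 1)).cost` samples
          ENNReal.ofReal (1 - p) ≤ μ {ω |
            let st : ℕ → EFG.SADOState Act Info := G.run ε br ξ fun t => ζ t ω
            ∃ t : ℕ,
              IsLeast {n | G.IsNash ε (G.lastWindowAverage (st n))} t ∧
              ((st (t + 1)).cost : ℝ) ≤
                C * G.sadoBound ε ((st t).window + 1) (G.restrSize (st t).pop) *
                  G.logFactor ε p ((st t).window + 1) (G.restrSize (st t).pop) ^ d} := by
  have hC : 0 < EFG.windowConst Δ δ + 2 * Δ := by
    have := EFG.windowConst_pos hΔ δ
    linarith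
  refine ⟨EFG.windowConst Δ δ + 2 * Δ, 1, hC, ?_⟩
  intro Act Info _ _ G hG hpay br hbr ξ hξ ε p hε hεΔ hp hp1 Ω _ μ _ ζ hζ
  refine (G.measure_failurePotential_lt_one_ge hG hΔ hδ hpay hbr hξ hp.le hζ).trans
    (MeasureTheory.measure_mono fun ω hω => ?_)
  rcases isEmpty_or_nonempty Info with hI | hI
  · obtain ⟨t, ht, hcost⟩ := G.exists_isLeast_isNash_of_isEmpty (br := br) (ξ := ξ)
      (w := fun t => ζ t ω) hε
    refine ⟨t, ht, ?_⟩
    rw [hcost, Nat.cast_zero, pow_one]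
    have hℓ := G.one_le_two_mul_logFactor hε hp
      ((G.run ε br ξ (fun t => ζ t ω) t).window + 1)
      (G.restrSize (G.run ε br ξ (fun t => ζ t ω) t).pop)
    exact mul_nonneg (mul_nonneg hC.le (G.sadoBound_nonneg hε _ _)) (by linarith)
  · exact G.exists_isLeast_isNash hG hΔ hδ hpay hbr hξ hε hεΔ hp hp1 (fun t => (hω t).1)
      (fun t => (hω t).2.1) fun t => (hω t).2.2
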